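/- Consider a system of $n\ge 1$ qubits with a bipartition into parts $A$ and $B$ of $n_A$ and $n_B$ qubits ($n=n_A+n_B$), and let $N_A=2^{n_A}$, $N_B=2^{n_B}$. For a state $\psi=\sum_{a,b}\psi_{ab}|a\rangle_A|b\rangle_B$ let $\mathcal N_2(\psi)=-\log\operatorname{tr}\rho_A^2$, where $\rho_A$ is the reduced density matrix of $|\psi\rangle\langle\psi|$ on $A$, and $\mathcal C_2(\psi)=-\log\sum_{a,b}|\psi_{ab}|^4$ (natural logarithms). Let $\mathcal E_{\rm ent.}(\psi)=\{(U_A\otimes U_B)|\psi\rangle\}$, with $U_A,U_B$ ranging over all unitaries on $A$ and on $B$, and $\mathcal E_{\rm coh.}(\psi)=\{PF|\psi\rangle\}$, with $P$ ranging over all permutations of the $2^n$ computational basis vectors and $F$ over all diagonal phase unitaries. For a nonnegative integer $k\le\min(n_A,n_B)$ and $K=2^k$, let $|\psi\rangle=K^{-1/2}\sum_{z=0}^{K-1}|z\rangle_A\otimes|z\rangle_B$, a maximally entangled state of Schmidt rank $K$. Let $\mathcal E$ be the orbit $\{(P_AF_A\otimes P_BF_B)|\psi\rangle\}$ of $\psi$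 under local permutation-and-phase unitaries, made into an ensemble by choosing the permutations $P_A,P_B$ of the $N_A$, resp. $N_B$, computational basis vectors uniformly at random and all phases in $F_A,F_B$ uniformly on the unit circle, all independently. For an integer $t\ge2$ let $$\epsilon_t=\tfrac12\Big\|\,\mathbb E_{\phi\sim\mathcal E}\big[(|\phi\rangle\langle\phi|)^{\otimes t}\big]-\mathbb E_{\phi\sim\mathrm{Haar}}\big[(|\phi\rangle\langle\phi|)^{\otimes t}\big]\Big\|_1$$ be the error of $\mathcal E$ as an approximate state $t$-design, where Haar means the uniform distribution on unit vectors of the $n$-qubit space. Then $\psi$ is a unit vector, $\mathcal N_2(\psi)=\mathcal C_2(\psi)=k\log 2$, the set of states of $\mathcal E$ is exactly $\mathcal E_{\rm ent.}(\psi)\cap\mathcal E_{\rm coh.}(\psi)$, and there are an absolute constant $C>0$ and, for every $t\ge 2$, a constant $c_t>0$ depending only on $t$, such that for all $n_A,n_B,k$ as above $$c_t\,e^{-\mathcal N_2(\psi)}\le\epsilon_t\le C\,t^2e^{-\mathcal N_2(\psi)},\qquad c_t\,e^{-\mathcal C_2(\psi)}\le\epsilon_t\le C\,t^2e^{-\mathcal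 C_2(\psi)},\qquad \epsilon_t\le C\,t^2/K .$$ In particular, for constant $t$, $\epsilon_t=\Theta(e^{-\mathcal N_2(\psi)})=\Theta(e^{-\mathcal C_2(\psi)})=O(t^2/K)$. -/

import Mathlib

open MeasureTheory
open scoped Kronecker ComplexConjugate

noncomputable section

/-- State vectors of a quantum system whose computational basis is labelled by `ι`. -/
abbrev Ket (ι : Type) [Fintype ι] : Type := EuclideanSpace ℂ ι

/-- Basis labels of a system of `n` qubits. -/
abbrev Qubits (n : ℕ) : Type := Fin (2 ^ n)

section Single

variable {ι : Type} [Fintype ι] [DecidableEq ι]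

/-- An operator, given by its matrix in the computational basis, applied to a state vector. -/
def applyOp (M : Matrix ι ι ℂ) (ψ : Ket ι) : Ket ι := WithLp.toLp 2 (M.mulVec ψ.ofLp)

/-- The permutation operator sending the basis vector `z` to the basis vector `p z`. -/
def permOp (p : Equiv.Perm ι) : Matrix ι ι ℂ :=
  Matrix.of fun x z => if x = p z then 1 else 0

/-- The phase operator multiplying the basis vector `z` by `exp (2 π i f(z))`. -/
def phaseOp (f : ι → ℝ) : Matrix ι ι ℂ :=
  Matrix.diagonal fun z => Complex.exp (2 * Real.pi * Complex.I * (f z : ℂ))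

/-- The amplitudes of the `t`-fold tensor power of `φ` in the product basis. -/
def tensorPow (t : ℕ) (φ : Ket ι) : (Fin t → ι) → ℂ := fun x => ∏ i, φ (x i)

/-- The `t`-th moment `E_{φ ∼ μ} [(|φ⟩⟨φ|)^{⊗ t}]` of an ensemble `μ` of states. -/
def moment (t : ℕ) (μ : Measure (Ket ι)) : Matrix (Fin t → ι) (Fin t → ι) ℂ :=
  Matrix.of fun x y => ∫ φ, tensorPow t φ x * conj (tensorPow t φ y) ∂μ

/-- Haar random states: the uniform (normalized surface) probability measure on the unit sphere. -/
def haarStates (ι : Type) [Fintype ι] : Measure (Ket ι) :=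
  (((volume : Measure (Ket ι)).toSphere Set.univ)⁻¹ •
    (volume : Measure (Ket ι)).toSphere).map Subtype.val

/-- The trace norm: the sum of the singular values. -/
def traceNorm (M : Matrix ι ι ℂ) : ℝ :=
  ∑ i, Real.sqrt ((Matrix.isHermitian_conjTranspose_mul_self M).eigenvalues i)

/-- The trace distance. -/
def traceDist (ρ σ : Matrix ι ι ℂ) : ℝ := traceNorm (ρ - σ) / 2

/-- The error of an ensemble as an approximate state `t`-design: the ensemble is an approximate
state `t`-design with error `ε` if and only if this number is at most `ε`. -/
def designError (t : ℕ) (μ : Measure (Ket ι)) : ℝ :=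
  traceDist (moment t μ) (moment t (haarStates ι))

/-- The states obtained from `ψ` by permutation and phase operators. -/
def cohEnsemble (ψ : Ket ι) : Set (Ket ι) :=
  {φ | ∃ (p : Equiv.Perm ι) (f : ι → ℝ), φ = applyOp (permOp p * phaseOp f) ψ}

/-- The second Rényi entropy of coherence: the second Rényi entropy of the outcome distribution
of a measurement in the computational basis. -/
def cohEntropy (ψ : Ket ι) : ℝ := -Real.log (∑ x, (‖ψ x‖ ^ 2) ^ 2)

/-- The law of independent phases `f z`, each uniform on `[0, 1)`. -/
def uniformPhases (ι : Type) [Fintype ι] : Measure (ι → ℝ) :=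
  Measure.pi fun _ => volume.restrict (Set.Ico 0 1)

end Single

section Bipartite

variable {α β : Type} [Fintype α] [Fintype β] [DecidableEq α] [DecidableEq β]

/-- The states obtained from `ψ` by local unitary operators `U_A ⊗ U_B`. -/
def entEnsemble (ψ : Ket (α × β)) : Set (Ket (α × β)) :=
  {φ | ∃ U ∈ Matrix.unitaryGroup α ℂ, ∃ V ∈ Matrix.unitaryGroup β ℂ, φ = applyOp (U ⊗ₖ V) ψ}

/-- The reduced density matrix of `|ψ⟩⟨ψ|` on `A`. -/
def reducedA (ψ : Ket (α × β)) : Matrix α α ℂ :=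
  Matrix.of fun a a' => ∑ b, ψ (a, b) * conj (ψ (a', b))

/-- The second Rényi entanglement entropy `-log tr ρ_A ^ 2`. -/
def entEntropy (ψ : Ket (α × β)) : ℝ :=
  -Real.log (reducedA ψ * reducedA ψ).trace.re

/-- The local permutation-and-phase unitary `(P_A F_A) ⊗ (P_B F_B)`. -/
def localPF (pA : Equiv.Perm α) (pB : Equiv.Perm β) (fA : α → ℝ) (fB : β → ℝ) :
    Matrix (α × β) (α × β) ℂ :=
  (permOp pA * phaseOp fA) ⊗ₖ (permOp pB * phaseOp fB)

/-- The orbit of `ψ` under local permutation-and-phase unitaries. -/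
def localPFOrbit (ψ : Ket (α × β)) : Set (Ket (α × β)) :=
  {φ | ∃ pA pB fA fB, φ = applyOp (localPF pA pB fA fB) ψ}

/-- The uniform ensemble on that orbit: the law of `(P_A F_A) ⊗ (P_B F_B) |ψ⟩` for independent
uniformly random permutations and independent uniformly random phases. -/
def localPFEnsemble (ψ : Ket (α × β)) : Measure (Ket (α × β)) :=
  ((Fintype.card (Equiv.Perm α) * Fintype.card (Equiv.Perm β) : ℕ) : ENNReal)⁻¹ •
    ∑ pA : Equiv.Perm α, ∑ pB : Equiv.Perm β,
      ((uniformPhases α).prod (uniformPhases β)).map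
        fun f => applyOp (localPF pA pB f.1 f.2) ψ

end Bipartite

/-- The maximally entangled state `K^{-1/2} ∑_{z < K} |z⟩_A ⊗ |z⟩_B` of Schmidt rank `K = 2 ^ k`
(for `k ≤ nA` and `k ≤ nB`). -/
def maxEntangled (nA nB k : ℕ) : Ket (Qubits nA × Qubits nB) :=
  WithLp.toLp 2 fun x =>
    if x.1.val = x.2.val ∧ x.1.val < 2 ^ k then ((1 / Real.sqrt (2 ^ k) : ℝ) : ℂ) else 0

end

/-!
Let `K` be the Schmidt rank of the maximally entangled state `ψ`. The design error of its local
orbit is a classical total variation distance. Call the numbers of times that the labels occur in a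
`t`-tuple of basis labels its occupation numbers. For both ensembles the entries of the
`t`-th moment between tuples with different occupation numbers vanish: for Haar random states by
invariance under all diagonal phases (`moment_haarStates`), and for the local orbit because random
phases on `A` fix the occupation numbers on `A`, and in each state of the orbit the label on `A`
determines the label on `B` (`moment_localPFEnsemble`). The remaining entries are the probabilities
of the outcomes `x` when `t` copies are measured in the computational basis, and depend only on the
occupation numbers. The trace norm of such a matrix is the `ℓ¹` norm of its diagonal
(`traceNorm_fibreMatrix`).

For the upper bound, condition on the outcomes being locally distinct: no two of them agree on `A`
or on `B`. Local permutations act transitively on such tuples, so both outcome distributions are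
uniform there, and the distance is at most the sum of the two probabilities that local distinctness
fails. By a union bound this needs only the collision probabilities of two outcomes: they are
`1 / K` for the orbit, and at most `2 / N_A` and `2 / N_B` for Haar random states. The latter follow
from the fourth moments of the amplitudes (`haarStates_integral_norm_sq_mul`), which invariance
under permutations and under a few explicit reflections determines.

For the lower bound, two outcomes coincide with probability `1 / K` for the orbit and
`2 / (N_A N_B + 1)` for Haar random states, and these differ by at least `1 / (5 K)` since
`N_A N_B ≥ max (K ^ 2) 2`.

A state in both orbits has `K` amplitudes of equal modulus, and its reduced density matrix has the
purity `1 / K` of `ψ`. This is the least purity that such a state can have, and it is attained only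
if no two amplitudes share a row or a column (`isFlatMatching_of_reducedA_trace_sq`). The support is
then a partial matching, and extending its two partial injections to permutations of the basis
labels exhibits the state as an element of the local orbit.
-/

noncomputable section

/-! ### Trace norms of block matrices -/

section TraceNorm

open scoped MatrixOrder ComplexOrder

variable {ι τ : Type} [Fintype ι] [DecidableEq ι] [DecidableEq τ]

/-- The trace norm of `M` is the trace of `|M|`, the positive semidefinite square root `S` of
`Mᴴ * M`. -/
theorem traceNorm_eq_trace_of_posSemidef {M S : Matrix ι ι ℂ} (hS : S.PosSemidef)
    (h : M.conjTranspose * M = S * S) : (traceNorm M : ℂ) = S.trace := by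
  have hM := Matrix.isHermitian_conjTranspose_mul_self M
  have hsq : CFC.sqrt (M.conjTranspose * M) = S := CFC.sqrt_unique h.symm hS.nonneg
  have hnn : 0 ≤ M.conjTranspose * M :=
    (Matrix.posSemidef_conjTranspose_mul_self M).nonneg
  rw [CFC.sqrt_eq_real_sqrt _ hnn, cfcₙ_eq_cfc (hf0 := Real.sqrt_zero), hM.cfc_eq] at hsq
  rw [← hsq, Matrix.IsHermitian.cfc, Unitary.conjStarAlgAut_apply, Matrix.trace_mul_cycle]
  simp [traceNorm, Matrix.trace]

/-- The matrix whose entry at `(x, y)` is `d x` if `x` and `y` have the same label under `κ`, and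
`0` otherwise. For `d` constant on the fibres of `κ` it is block diagonal, with a multiple of the
all-ones matrix on each fibre. -/
def fibreMatrix (κ : ι → τ) (d : ι → ℝ) : Matrix ι ι ℂ :=
  Matrix.of fun x y => if κ x = κ y then (d x : ℂ) else 0

/-- The absolute value of a fibre matrix is the fibre matrix of `|d|`, so the trace norm is the
`ℓ¹` norm of the diagonal. -/
theorem traceNorm_fibreMatrix (κ : ι → τ) (d : ι → ℝ) (hd : ∀ x y, κ x = κ y → d x = d y) :
    traceNorm (fibreMatrix κ d) = ∑ x, |d x| := by
  set n : ι → ℝ := fun x => ((Finset.univ.filter fun w => κ w = κ x).card : ℝ) with hn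
  have hnpos : ∀ x, 0 < n x := fun x => by
    simp only [hn, Nat.cast_pos, Finset.card_pos]
    exact ⟨x, by simp⟩
  have hnκ : ∀ x y, κ x = κ y → n x = n y := fun x y h => by simp only [hn, h]
  have hmul : ∀ (e g : ι → ℝ), (∀ x y, κ x = κ y → e x = e y) → (∀ x y, κ x = κ y → g x = g y) →
      (fibreMatrix κ e).conjTranspose * fibreMatrix κ g =
        fibreMatrix κ fun x => n x * (e x * g x) := by
    intro e g he hg
    ext x y
    simp only [fibreMatrix, Matrix.mul_apply, Matrix.conjTranspose_apply, Matrix.of_apply]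
    by_cases hxy : κ x = κ y
    · have : ∀ w, star (if κ w = κ x then (e w : ℂ) else 0) * (if κ w = κ y then (g w : ℂ) else 0)
          = if κ w = κ x then ((e x * g x : ℝ) : ℂ) else 0 := by
        intro w
        by_cases hw : κ w = κ x
        · rw [if_pos hw, if_pos (hw.trans hxy), if_pos hw, he w x hw, hg w x hw]
          simp
        · simp [hw]
      simp_rw [this, if_pos hxy, ← Finset.sum_filter, Finset.sum_const, hn]
      simp
    · rw [if_neg hxy]
      refine Finset.sum_eq_zero fun w _ => ?_
      by_cases hw : κ w = κ x
      · rw [if_neg (fun h => hxy (hw.symm.trans h)), mul_zero]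
      · simp [hw]
  have habs : ∀ x y, κ x = κ y → |d x| = |d y| := fun x y h => by rw [hd x y h]
  have hrt : ∀ x y, κ x = κ y → √(|d x| / n x) = √(|d y| / n y) := fun x y h => by
    rw [hd x y h, hnκ x y h]
  -- `|d|` has a square root of the same block form, hence its fibre matrix is positive.
  have hroot : (fibreMatrix κ fun x => √(|d x| / n x)).conjTranspose *
      (fibreMatrix κ fun x => √(|d x| / n x)) = fibreMatrix κ fun x => |d x| := by
    rw [hmul _ _ hrt hrt]
    congr 1
    ext x
    rw [Real.mul_self_sqrt (div_nonneg (abs_nonneg _) (hnpos x).le),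
      mul_div_cancel₀ _ (hnpos x).ne']
  have hpsd : (fibreMatrix κ fun x => |d x|).PosSemidef := by
    rw [← hroot]; exact Matrix.posSemidef_conjTranspose_mul_self _
  have hsq : (fibreMatrix κ d).conjTranspose * fibreMatrix κ d =
      (fibreMatrix κ fun x => |d x|) * fibreMatrix κ fun x => |d x| := by
    have h := hmul _ _ habs habs
    rw [hpsd.isHermitian.eq] at h
    rw [h, hmul _ _ hd hd]
    simp [abs_mul_abs_self]
  have key := traceNorm_eq_trace_of_posSemidef hpsd hsq
  have : ((∑ x, |d x| : ℝ) : ℂ) = (fibreMatrix κ fun x => |d x|).trace := by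
    simp [Matrix.trace, fibreMatrix]
  exact_mod_cast key.trans this.symm

end TraceNorm

/-! ### Finite probability distributions -/

section Finite

/-- Two distributions that are both uniform on `G` are as close as the masses that they put
outside `G` are small. -/
theorem sum_abs_sub_le_of_const_on {X : Type*} [Fintype X] [DecidableEq X] {p q : X → ℝ}
    (hp : ∀ x, 0 ≤ p x) (hq : ∀ x, 0 ≤ q x) (hp1 : ∑ x, p x = 1) (hq1 : ∑ x, q x = 1)
    (G : Finset X) (hpG : ∀ x ∈ G, ∀ y ∈ G, p x = p y) (hqG : ∀ x ∈ G, ∀ y ∈ G, q x = q y) :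
    ∑ x, |p x - q x| ≤ 2 * (∑ x ∈ Gᶜ, p x + ∑ x ∈ Gᶜ, q x) := by
  have hout : ∑ x ∈ Gᶜ, |p x - q x| ≤ ∑ x ∈ Gᶜ, p x + ∑ x ∈ Gᶜ, q x := by
    rw [← Finset.sum_add_distrib]
    refine Finset.sum_le_sum fun x _ => ?_
    rw [abs_le]
    constructor <;> linarith [hp x, hq x]
  -- On `G` the difference is constant, hence of constant sign.
  have hin : ∑ x ∈ G, |p x - q x| = |∑ x ∈ G, (p x - q x)| := by
    rcases G.eq_empty_or_nonempty with rfl | ⟨y, hy⟩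
    · simp
    · have h : ∀ x ∈ G, p x - q x = p y - q y := fun x hx => by
        rw [hpG x hx y hy, hqG x hx y hy]
      rw [Finset.sum_congr rfl h, Finset.sum_congr rfl fun x hx => by rw [h x hx]]
      simp only [Finset.sum_const, nsmul_eq_mul, abs_mul, Nat.abs_cast]
  have hpc := Finset.sum_add_sum_compl G p
  have hqc := Finset.sum_add_sum_compl G q
  have hp0 : 0 ≤ ∑ x ∈ Gᶜ, p x := Finset.sum_nonneg fun x _ => hp x
  have hq0 : 0 ≤ ∑ x ∈ Gᶜ, q x := Finset.sum_nonneg fun x _ => hq x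
  have habs : |∑ x ∈ G, (p x - q x)| ≤ ∑ x ∈ Gᶜ, p x + ∑ x ∈ Gᶜ, q x := by
    rw [Finset.sum_sub_distrib, abs_le]
    constructor <;> linarith
  rw [← Finset.sum_add_sum_compl G]
  linarith

/-- The law of two of the coordinates of a family of independent random variables, each with
distribution `q`. -/
theorem sum_ite_prod_eq {ι κ : Type*} [Fintype ι] [DecidableEq ι] [Fintype κ] [DecidableEq κ]
    {q : ι → ℝ} (hq : ∑ u, q u = 1) {i j : κ} (hij : i ≠ j) (R : ι → ι → Prop)
    [DecidableRel R] :
    ∑ x : κ → ι, (if R (x i) (x j) then ∏ l, q (x l) else 0) =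
      ∑ u, ∑ v, if R u v then q u * q v else 0 := by
  -- With the two outcomes fixed, the summand is a product over the coordinates.
  have hpt : ∀ u v, ∑ x : κ → ι, (if x i = u ∧ x j = v then ∏ l, q (x l) else 0) = q u * q v := by
    intro u v
    let g : κ → ι → ℝ := fun l w =>
      if l = i then (if w = u then q w else 0) else if l = j then (if w = v then q w else 0)
      else q w
    have h1 : ∀ x : κ → ι, (if x i = u ∧ x j = v then ∏ l, q (x l) else 0) =
        ∏ l, g l (x l) := by
      intro x
      split_ifs with h
      · refine Finset.prod_congr rfl fun l _ => ?_
        simp only [g]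
        by_cases hli : l = i
        · subst hli; simp [h.1]
        · by_cases hlj : l = j
          · subst hlj; simp [h.2, hli]
          · simp [hli, hlj]
      · rw [not_and_or] at h
        rcases h with h | h
        · exact (Finset.prod_eq_zero (Finset.mem_univ i) (by simp [g, h])).symm
        · exact (Finset.prod_eq_zero (Finset.mem_univ j) (by simp [g, h, hij.symm])).symm
    have h2 : ∀ l, ∑ w, g l w = (if l = i then q u else 1) * (if l = j then q v else 1) := by
      intro l
      by_cases hli : l = i
      · subst hli; simp [g, hij]
      · by_cases hlj : l = j
        · subst hlj; simp [g, hli]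
        · simp [g, hli, hlj, hq]
    simp_rw [h1]
    rw [← Fintype.piFinset_univ, ← Finset.prod_univ_sum]
    simp_rw [h2, Finset.prod_mul_distrib]
    simp
  have h3 : ∀ x : κ → ι, (if R (x i) (x j) then ∏ l, q (x l) else 0) =
      ∑ u, ∑ v, if R u v then (if x i = u ∧ x j = v then ∏ l, q (x l) else 0) else 0 := by
    intro x
    rw [Finset.sum_eq_single (x i), Finset.sum_eq_single (x j)]
    · simp
    · intro v _ hv; simp [hv.symm]
    · simp
    · intro u _ hu
      exact Finset.sum_eq_zero fun v _ => by simp [hu.symm]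
    · simp
  simp_rw [h3]
  rw [Finset.sum_comm]
  refine Finset.sum_congr rfl fun u _ => ?_
  rw [Finset.sum_comm]
  refine Finset.sum_congr rfl fun v _ => ?_
  split_ifs
  · exact hpt u v
  · simp

end Finite

/-! ### Moments of ensembles of unit vectors -/

section Moments

variable {ι : Type} [Fintype ι] {t : ℕ}

/-- The probability of the outcomes `x` when `t` copies of a random state are measured in the
computational basis. -/
def outcomeProb (t : ℕ) (μ : Measure (Ket ι)) (x : Fin t → ι) : ℝ :=
  ∫ φ, ∏ i, ‖φ (x i)‖ ^ 2 ∂μ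

theorem outcomeProb_nonneg (μ : Measure (Ket ι)) (x : Fin t → ι) : 0 ≤ outcomeProb t μ x :=
  integral_nonneg fun _ => Finset.prod_nonneg fun _ _ => sq_nonneg _

theorem sum_norm_sq_eq_one {φ : Ket ι} (h : ‖φ‖ = 1) : ∑ u, ‖φ u‖ ^ 2 = 1 := by
  rw [← EuclideanSpace.norm_sq_eq, h, one_pow]

theorem integrable_of_continuous {E : Type*} [NormedAddCommGroup E] [SecondCountableTopology E]
    {μ : Measure (Ket ι)} [IsFiniteMeasure μ]
    (hμ : ∀ᵐ φ ∂μ, ‖φ‖ = 1) {F : Ket ι → E} (hF : Continuous F) : Integrable F μ := by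
  obtain ⟨C, hC⟩ := (isCompact_sphere (0 : Ket ι) 1).exists_bound_of_continuousOn hF.continuousOn
  refine Integrable.of_bound hF.aestronglyMeasurable C ?_
  filter_upwards [hμ] with φ hφ
  exact hC φ (by simpa using hφ)

theorem sum_outcomeProb {μ : Measure (Ket ι)} [IsProbabilityMeasure μ]
    (hμ : ∀ᵐ φ ∂μ, ‖φ‖ = 1) : ∑ x, outcomeProb t μ x = 1 := by
  unfold outcomeProb
  rw [← integral_finsetSum _ fun x _ => integrable_of_continuous hμ (by fun_prop)]
  have : ∀ᵐ φ ∂μ, ∑ x : Fin t → ι, ∏ i, ‖φ (x i)‖ ^ 2 = 1 := by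
    filter_upwards [hμ] with φ hφ
    rw [← Fintype.sum_pow fun u => ‖φ u‖ ^ 2, sum_norm_sq_eq_one hφ, one_pow]
  rw [integral_congr_ae this]
  simp

variable [DecidableEq ι]

/-- The probability that the outcomes for two different copies are related by `R`. -/
theorem sum_outcomeProb_ite {μ : Measure (Ket ι)} [IsFiniteMeasure μ]
    (hμ : ∀ᵐ φ ∂μ, ‖φ‖ = 1) {i j : Fin t} (hij : i ≠ j) (R : ι → ι → Prop) [DecidableRel R] :
    ∑ x, (if R (x i) (x j) then outcomeProb t μ x else 0) =
      ∫ φ, ∑ u, ∑ v, (if R u v then ‖φ u‖ ^ 2 * ‖φ v‖ ^ 2 else 0) ∂μ := by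
  have h : ∀ x : Fin t → ι, (if R (x i) (x j) then outcomeProb t μ x else 0) =
      ∫ φ, (if R (x i) (x j) then ∏ l, ‖φ (x l)‖ ^ 2 else 0) ∂μ := by
    intro x
    split_ifs <;> simp [outcomeProb]
  simp_rw [h]
  rw [← integral_finsetSum _ fun x _ => integrable_of_continuous hμ (by split_ifs <;> fun_prop)]
  refine integral_congr_ae ?_
  filter_upwards [hμ] with φ hφ
  exact sum_ite_prod_eq (sum_norm_sq_eq_one hφ) hij R

/-- The occupation numbers of a tuple of basis labels: how often each label occurs. Two tuples
have the same occupation numbers if and only if they are permutations of each other. -/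
def occupation (x : Fin t → ι) : ι → ℕ := fun u => (Finset.univ.filter fun i => x i = u).card

theorem prod_comp_eq_prod_pow_occupation {M : Type*} [CommMonoid M] (g : ι → M) (x : Fin t → ι) :
    ∏ i, g (x i) = ∏ u, g u ^ occupation x u := by
  simp_rw [occupation]
  rw [Finset.prod_comp]
  refine Finset.prod_subset (Finset.subset_univ _) fun u _ hu => ?_
  have : (Finset.univ.filter fun i => x i = u) = ∅ := by
    ext i
    simp only [Finset.mem_filter, Finset.mem_univ, true_and, Finset.notMem_empty, iff_false]
    rintro rfl
    exact hu (Finset.mem_image_of_mem _ (Finset.mem_univ i))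
  simp [this]

theorem outcomeProb_congr (μ : Measure (Ket ι)) {x y : Fin t → ι}
    (h : occupation x = occupation y) : outcomeProb t μ x = outcomeProb t μ y := by
  unfold outcomeProb
  congr 1
  ext φ
  rw [prod_comp_eq_prod_pow_occupation (fun u => ‖φ u‖ ^ 2),
    prod_comp_eq_prod_pow_occupation (fun u => ‖φ u‖ ^ 2), h]

/-- The moment is determined by the outcome probabilities, if the entries between tuples with
different occupation numbers vanish. -/
theorem moment_eq_fibreMatrix {μ : Measure (Ket ι)}
    (h : ∀ x y : Fin t → ι, occupation x ≠ occupation y →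
      ∫ φ, tensorPow t φ x * conj (tensorPow t φ y) ∂μ = 0) :
    moment t μ = fibreMatrix occupation (outcomeProb t μ) := by
  ext x y
  simp only [moment, fibreMatrix, Matrix.of_apply]
  split_ifs with hxy
  · rw [outcomeProb, ← integral_complex_ofReal]
    congr 1
    ext φ
    have : tensorPow t φ y = tensorPow t φ x := by
      simp only [tensorPow]
      rw [prod_comp_eq_prod_pow_occupation φ, prod_comp_eq_prod_pow_occupation φ, hxy]
    rw [this, tensorPow, map_prod, ← Finset.prod_mul_distrib]
    push_cast
    refine Finset.prod_congr rfl fun i _ => ?_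
    rw [Complex.mul_conj, Complex.normSq_eq_norm_sq]
    push_cast; rfl
  · exact h x y hxy

/-- If both moments are block diagonal with respect to the occupation numbers, then the design
error is the total variation distance of the outcome distributions. -/
theorem designError_eq_sum {μ : Measure (Ket ι)}
    (h₁ : moment t μ = fibreMatrix occupation (outcomeProb t μ))
    (h₂ : moment t (haarStates ι) = fibreMatrix occupation (outcomeProb t (haarStates ι))) :
    designError t μ =
      (∑ x, |outcomeProb t μ x - outcomeProb t (haarStates ι) x|) / 2 := by
  rw [designError, traceDist, h₁, h₂, ← traceNorm_fibreMatrix occupation]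
  · congr 2
    ext x y
    simp only [fibreMatrix, Matrix.sub_apply, Matrix.of_apply]
    split_ifs <;> simp
  · intro x y hxy
    rw [outcomeProb_congr μ hxy, outcomeProb_congr _ hxy]

end Moments

/-! ### Haar random states -/

section Haar

open scoped Pointwise

variable {ι : Type} [Fintype ι]

instance [Nonempty ι] : IsProbabilityMeasure (haarStates ι) := by
  constructor
  rw [haarStates, Measure.map_apply measurable_subtype_coe .univ, Set.preimage_univ,
    Measure.smul_apply, smul_eq_mul]
  refine ENNReal.inv_mul_cancel ?_ (measure_ne_top _ _)
  rw [Ne, Measure.measure_univ_eq_zero]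
  exact Measure.toSphere_ne_zero _

theorem ae_haarStates_norm : ∀ᵐ φ ∂haarStates ι, ‖φ‖ = 1 := by
  rw [haarStates, ae_map_iff measurable_subtype_coe.aemeasurable
    (measurableSet_eq_fun measurable_norm measurable_const)]
  exact ae_of_all _ fun φ => by simp

/-- The image of Lebesgue measure under a linear isometry is translation invariant and gives the
unit ball the same volume. -/
theorem map_volume_linearIsometryEquiv (e : Ket ι ≃ₗᵢ[ℂ] Ket ι) :
    (volume : Measure (Ket ι)).map e = volume := by
  let e' : Ket ι ≃ₗᵢ[ℝ] Ket ι :=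
    { e.toLinearEquiv.restrictScalars ℝ with norm_map' := e.norm_map }
  exact e'.measurePreserving.map_eq

/-- A linear isometry maps the cone over a set of unit vectors to the cone over its image, and so
preserves the surface measure because it preserves volume. -/
theorem map_haarStates (e : Ket ι ≃ₗᵢ[ℂ] Ket ι) : (haarStates ι).map e = haarStates ι := by
  have he : Measurable e := e.continuous.measurable
  have hvol : MeasurePreserving e (volume : Measure (Ket ι)) volume :=
    ⟨he, map_volume_linearIsometryEquiv e⟩
  ext s hs
  rw [Measure.map_apply he hs, haarStates, Measure.map_apply measurable_subtype_coe (he hs),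
    Measure.map_apply measurable_subtype_coe hs, Measure.smul_apply, Measure.smul_apply,
    Measure.toSphere_apply' _ (measurable_subtype_coe (he hs)),
    Measure.toSphere_apply' _ (measurable_subtype_coe hs)]
  congr 2
  have hcone : Set.Ioo (0 : ℝ) 1 • (Subtype.val '' (Subtype.val ⁻¹' (e ⁻¹' s) :
        Set (Metric.sphere (0 : Ket ι) 1))) =
      e ⁻¹' (Set.Ioo (0 : ℝ) 1 • (Subtype.val '' (Subtype.val ⁻¹' s :
        Set (Metric.sphere (0 : Ket ι) 1)))) := by
    ext φ
    simp only [Set.mem_smul, Set.mem_image, Set.mem_preimage, Subtype.exists,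
      mem_sphere_zero_iff_norm, exists_and_right, exists_eq_right]
    constructor
    · rintro ⟨r, hr, χ, ⟨hχ, hs⟩, rfl⟩
      exact ⟨r, hr, e χ, ⟨by simpa using hχ, hs⟩,
        (map_smul (e.toLinearEquiv.restrictScalars ℝ) r χ).symm⟩
    · rintro ⟨r, hr, χ, ⟨hχ, hs⟩, h⟩
      exact ⟨r, hr, e.symm χ, ⟨by simpa using hχ, by simpa using hs⟩, by
        apply e.injective
        rw [← h]
        refine (map_smul (e.toLinearEquiv.restrictScalars ℝ) r (e.symm χ)).trans ?_
        simp⟩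
  rw [hcone]
  exact hvol.measure_preimage_equiv (f := e.toHomeomorph.toMeasurableEquiv) _


theorem applyOp_mul (M M' : Matrix ι ι ℂ) (φ : Ket ι) :
    applyOp (M * M') φ = applyOp M (applyOp M' φ) := by
  simp [applyOp]

variable [DecidableEq ι]

/-- The isometry of the state space given by a unitary matrix. -/
def unitaryIsometry (U : Matrix.unitaryGroup ι ℂ) : Ket ι ≃ₗᵢ[ℂ] Ket ι :=
  Unitary.linearIsometryEquiv ⟨Matrix.toEuclideanCLM (n := ι) (𝕜 := ℂ) U.1,
    Unitary.map_mem (Matrix.toEuclideanCLM (n := ι) (𝕜 := ℂ)) U.2⟩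

theorem norm_applyOp {U : Matrix ι ι ℂ} (hU : U ∈ Matrix.unitaryGroup ι ℂ) (φ : Ket ι) :
    ‖applyOp U φ‖ = ‖φ‖ :=
  (unitaryIsometry ⟨U, hU⟩).norm_map φ

/-- Haar random states are invariant under unitary operators. -/
theorem integral_haarStates_applyOp {E : Type*} [NormedAddCommGroup E] [NormedSpace ℝ E]
    {U : Matrix ι ι ℂ} (hU : U ∈ Matrix.unitaryGroup ι ℂ) (F : Ket ι → E) :
    ∫ φ, F (applyOp U φ) ∂haarStates ι = ∫ φ, F φ ∂haarStates ι := by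
  let e := unitaryIsometry ⟨U, hU⟩
  have h : MeasurePreserving e.toHomeomorph.toMeasurableEquiv (haarStates ι) (haarStates ι) :=
    ⟨e.continuous.measurable, map_haarStates e⟩
  exact h.integral_comp' F

theorem applyOp_permOp_apply (p : Equiv.Perm ι) (φ : Ket ι) (x : ι) :
    applyOp (permOp p) φ x = φ (p⁻¹ x) := by
  simp only [applyOp, permOp, Matrix.mulVec, dotProduct, Matrix.of_apply, ite_mul, one_mul,
    zero_mul]
  rw [Finset.sum_eq_single (p⁻¹ x)]
  · simp
  · intro z _ hz
    rw [if_neg]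
    rintro rfl
    simp at hz
  · simp

theorem applyOp_phaseOp_apply (f : ι → ℝ) (φ : Ket ι) (x : ι) :
    applyOp (phaseOp f) φ x = Complex.exp (2 * Real.pi * Complex.I * (f x : ℂ)) * φ x := by
  simp [applyOp, phaseOp, Matrix.mulVec_diagonal]

theorem permOp_mem_unitaryGroup (p : Equiv.Perm ι) : permOp p ∈ Matrix.unitaryGroup ι ℂ := by
  rw [Matrix.mem_unitaryGroup_iff']
  ext x y
  simp only [Matrix.star_eq_conjTranspose, Matrix.mul_apply, Matrix.conjTranspose_apply, permOp,
    Matrix.of_apply, Matrix.one_apply]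
  simp [apply_ite (star : ℂ → ℂ), eq_comm]

theorem conj_exp_phase_mul (r : ℝ) :
    conj (Complex.exp (2 * Real.pi * Complex.I * (r : ℂ))) *
      Complex.exp (2 * Real.pi * Complex.I * (r : ℂ)) = 1 := by
  rw [← Complex.exp_conj, ← Complex.exp_add]
  simp [map_ofNat]

theorem norm_exp_phase (r : ℝ) : ‖Complex.exp (2 * Real.pi * Complex.I * (r : ℂ))‖ = 1 := by
  rw [show 2 * (Real.pi : ℂ) * Complex.I * r = ((2 * Real.pi * r : ℝ) : ℂ) * Complex.I by
    push_cast; ring]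
  exact Complex.norm_exp_ofReal_mul_I _

theorem phaseOp_mem_unitaryGroup (f : ι → ℝ) : phaseOp f ∈ Matrix.unitaryGroup ι ℂ := by
  rw [Matrix.mem_unitaryGroup_iff', phaseOp, Matrix.star_eq_conjTranspose,
    Matrix.diagonal_conjTranspose, Matrix.diagonal_mul_diagonal, ← Matrix.diagonal_one]
  congr 1
  ext x
  exact conj_exp_phase_mul (f x)

theorem outcomeProb_haarStates_perm {t : ℕ} (p : Equiv.Perm ι) (x : Fin t → ι) :
    outcomeProb t (haarStates ι) (p ∘ x) = outcomeProb t (haarStates ι) x := by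
  rw [outcomeProb, ← integral_haarStates_applyOp (permOp_mem_unitaryGroup p)]
  simp [applyOp_permOp_apply, outcomeProb]

theorem tensorPow_applyOp_phaseOp {t : ℕ} (f : ι → ℝ) (φ : Ket ι) (x : Fin t → ι) :
    tensorPow t (applyOp (phaseOp f) φ) x =
      Complex.exp (2 * Real.pi * Complex.I * ((∑ i, f (x i) : ℝ) : ℂ)) * tensorPow t φ x := by
  simp only [tensorPow, applyOp_phaseOp_apply, Finset.prod_mul_distrib, ← Complex.exp_sum]
  push_cast
  rw [Finset.mul_sum]

/-- The moments of Haar random states are block diagonal with respect to the occupation numbers: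
shifting the phase of a basis vector that occurs more often in `x` than in `y` by a suitable amount
changes the sign of the entry at `(x, y)`. -/
theorem moment_haarStates (t : ℕ) :
    moment t (haarStates ι) = fibreMatrix occupation (outcomeProb t (haarStates ι)) := by
  refine moment_eq_fibreMatrix fun x y hxy => ?_
  obtain ⟨u, hu⟩ := Function.ne_iff.mp hxy
  set m : ℝ := (occupation x u : ℝ) - occupation y u with hm
  have hm0 : m ≠ 0 := sub_ne_zero.mpr (by exact_mod_cast hu)
  set f : ι → ℝ := fun w => if w = u then 1 / (2 * m) else 0
  have hf : ∀ z : Fin t → ι, ∑ i, f (z i) = occupation z u * (1 / (2 * m)) := fun z => by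
    simp [f, occupation, ← Finset.sum_filter]
  set I := ∫ φ, tensorPow t φ x * conj (tensorPow t φ y) ∂haarStates ι with hI
  have key : I = -I := by
    conv_lhs => rw [hI, ← integral_haarStates_applyOp (phaseOp_mem_unitaryGroup f)]
    rw [hI, ← integral_neg]
    congr 1
    ext φ
    rw [tensorPow_applyOp_phaseOp, tensorPow_applyOp_phaseOp, hf, hf, map_mul, ← Complex.exp_conj]
    rw [mul_mul_mul_comm, ← Complex.exp_add]
    have : 2 * (Real.pi : ℂ) * Complex.I * ((occupation x u * (1 / (2 * m)) : ℝ) : ℂ) +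
        conj (2 * (Real.pi : ℂ) * Complex.I * ((occupation y u * (1 / (2 * m)) : ℝ) : ℂ)) =
        Real.pi * Complex.I := by
      have h1 : (occupation x u : ℝ) * (1 / (2 * m)) - occupation y u * (1 / (2 * m)) = 1 / 2 := by
        rw [← sub_mul, ← hm]; field_simp
      have h2 := congrArg (Complex.ofReal) h1
      simp only [map_mul, Complex.conj_ofReal, Complex.conj_I, map_ofNat]
      push_cast at h2 ⊢
      linear_combination (2 * (Real.pi : ℂ) * Complex.I) * h2
    rw [this, Complex.exp_pi_mul_I, neg_one_mul]
  exact self_eq_neg.mp key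

/-- For `‖c‖ = 1`, the reflection along the vector with entries `1` at `u` and `2 c` at `v`, of
squared norm `5`. It mixes the amplitudes at `u` and `v` with coefficients `3 / 5` and `4 / 5`. -/
def pairReflection (u v : ι) (c : ℂ) : Matrix ι ι ℂ :=
  1 - (2 / 5 : ℂ) • Matrix.vecMulVec (Pi.single u 1 + Pi.single v (2 * c))
    (star (Pi.single u 1 + Pi.single v (2 * c)))

theorem pairReflection_mem_unitaryGroup {u v : ι} (huv : u ≠ v) {c : ℂ} (hc : conj c * c = 1) :
    pairReflection u v c ∈ Matrix.unitaryGroup ι ℂ := by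
  set w : ι → ℂ := Pi.single u 1 + Pi.single v (2 * c) with hw
  have hww : star w ⬝ᵥ w = 5 := by
    simp only [hw, dotProduct_add, dotProduct_single]
    simp [huv, huv.symm]
    linear_combination 4 * hc
  have hP : Matrix.vecMulVec w (star w) * Matrix.vecMulVec w (star w) =
      (5 : ℂ) • Matrix.vecMulVec w (star w) := by
    rw [Matrix.vecMulVec_mul_vecMulVec, hww]
    simp
  have hs : star (pairReflection u v c) = pairReflection u v c := by
    simp only [pairReflection, ← hw, star_sub, star_one, star_smul]
    congr 2
    · simp
    · rw [Matrix.star_eq_conjTranspose, Matrix.conjTranspose_vecMulVec, star_star]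
  rw [Matrix.mem_unitaryGroup_iff, hs, pairReflection, ← hw, sub_mul, one_mul, mul_sub, mul_one,
    Matrix.smul_mul, Matrix.mul_smul, hP]
  module

theorem applyOp_pairReflection_apply {u v : ι} (huv : u ≠ v) (c : ℂ) (φ : Ket ι) :
    applyOp (pairReflection u v c) φ u = (3 * φ u - 4 * conj c * φ v) / 5 := by
  simp only [applyOp, pairReflection, Matrix.sub_mulVec, Matrix.one_mulVec, Matrix.smul_mulVec,
    Matrix.vecMulVec_mulVec]
  simp [huv, add_dotProduct]
  ring

end Haar

/-! ### Second moments of the outcome probabilities of Haar random states -/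

section HaarFourth

variable {ι : Type} [Fintype ι]

theorem integral_sum_sum {F : ι → ι → Ket ι → ℝ} (hF : ∀ u v, Continuous (F u v)) [Nonempty ι] :
    ∫ φ, ∑ u, ∑ v, F u v φ ∂haarStates ι = ∑ u, ∑ v, ∫ φ, F u v φ ∂haarStates ι := by
  have hint : ∀ {G : Ket ι → ℝ}, Continuous G → Integrable G (haarStates ι) := fun hG =>
    integrable_of_continuous ae_haarStates_norm hG
  rw [integral_finsetSum _ fun u _ => hint (continuous_finsetSum _ fun v _ => hF u v)]
  exact Finset.sum_congr rfl fun u _ => integral_finsetSum _ fun v _ => hint (hF u v)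

variable [DecidableEq ι]

/-- Invariance under the reflections `pairReflection u v c` for `c = 1, -1, i, -i` forces the
Gaussian value of the ratio of these moments. -/
theorem haarStates_integral_norm_pow_four {u v : ι} (huv : u ≠ v) :
    ∫ φ, ‖φ u‖ ^ 2 * ‖φ u‖ ^ 2 ∂haarStates ι = 2 * ∫ φ, ‖φ u‖ ^ 2 * ‖φ v‖ ^ 2 ∂haarStates ι := by
  have : Nonempty ι := ⟨u⟩
  have hint : ∀ {F : Ket ι → ℝ}, Continuous F → Integrable F (haarStates ι) := fun hF =>
    integrable_of_continuous ae_haarStates_norm hF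
  set A := ∫ φ, ‖φ u‖ ^ 2 * ‖φ u‖ ^ 2 ∂haarStates ι with hA
  set B := ∫ φ, ‖φ u‖ ^ 2 * ‖φ v‖ ^ 2 ∂haarStates ι with hB
  have hAv : ∫ φ, ‖φ v‖ ^ 2 * ‖φ v‖ ^ 2 ∂haarStates ι = A := by
    rw [hA, ← integral_haarStates_applyOp (permOp_mem_unitaryGroup (Equiv.swap u v))]
    simp [applyOp_permOp_apply]
  have hR : ∀ c : ℂ, conj c * c = 1 →
      A = ∫ φ, ‖3 * φ u - 4 * conj c * φ v‖ ^ 2 * ‖3 * φ u - 4 * conj c * φ v‖ ^ 2 / 625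
        ∂haarStates ι := by
    intro c hc
    rw [hA, ← integral_haarStates_applyOp (pairReflection_mem_unitaryGroup huv hc)]
    congr 1
    ext φ
    rw [applyOp_pairReflection_apply huv, norm_div]
    norm_num
    ring
  -- Averaging over the four phases cancels every term in which the phases of `φ u`, `φ v` matter.
  have hid : ∀ a b : ℂ,
      ‖3 * a - 4 * conj 1 * b‖ ^ 2 * ‖3 * a - 4 * conj 1 * b‖ ^ 2 / 625 +
      ‖3 * a - 4 * conj (-1) * b‖ ^ 2 * ‖3 * a - 4 * conj (-1) * b‖ ^ 2 / 625 +
      ‖3 * a - 4 * conj Complex.I * b‖ ^ 2 * ‖3 * a - 4 * conj Complex.I * b‖ ^ 2 / 625 +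
      ‖3 * a - 4 * conj (-Complex.I) * b‖ ^ 2 * ‖3 * a - 4 * conj (-Complex.I) * b‖ ^ 2 / 625 =
      4 / 625 * (81 * (‖a‖ ^ 2 * ‖a‖ ^ 2) + 256 * (‖b‖ ^ 2 * ‖b‖ ^ 2) +
        576 * (‖a‖ ^ 2 * ‖b‖ ^ 2)) := by
    intro a b
    simp only [← Complex.normSq_eq_norm_sq, Complex.normSq_apply]
    simp
    ring
  have hsum : A + A + A + A = 4 / 625 * (81 * A + 256 * A + 576 * B) := by
    have h := integral_congr_ae (μ := haarStates ι) (ae_of_all _ fun φ => hid (φ u) (φ v))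
    rw [integral_add (hint (by fun_prop)) (hint (by fun_prop)),
      integral_add (hint (by fun_prop)) (hint (by fun_prop)),
      integral_add (hint (by fun_prop)) (hint (by fun_prop)),
      ← hR 1 (by simp), ← hR (-1) (by simp), ← hR Complex.I (by simp),
      ← hR (-Complex.I) (by simp), integral_const_mul,
      integral_add (hint (by fun_prop)) (hint (by fun_prop)),
      integral_add (hint (by fun_prop)) (hint (by fun_prop)),
      integral_const_mul, integral_const_mul, integral_const_mul, hAv] at h
    exact h
  linarith

/-- The second moments of the outcome probabilities of Haar random states. -/
theorem haarStates_integral_norm_sq_mul (u v : ι) :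
    ∫ φ, ‖φ u‖ ^ 2 * ‖φ v‖ ^ 2 ∂haarStates ι =
      (if u = v then 2 else 1) / (Fintype.card ι * (Fintype.card ι + 1)) := by
  have : Nonempty ι := ⟨u⟩
  set N : ℝ := (Fintype.card ι : ℝ) with hN
  have hNpos : 0 < N := by rw [hN]; exact_mod_cast Fintype.card_pos
  set A := ∫ φ, ‖φ u‖ ^ 2 * ‖φ u‖ ^ 2 ∂haarStates ι with hA
  have hdiag : ∀ w, ∫ φ, ‖φ w‖ ^ 2 * ‖φ w‖ ^ 2 ∂haarStates ι = A := fun w => by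
    rw [hA, ← integral_haarStates_applyOp (permOp_mem_unitaryGroup (Equiv.swap u w))]
    simp [applyOp_permOp_apply]
  have hoff : ∀ w w', ∫ φ, ‖φ w‖ ^ 2 * ‖φ w'‖ ^ 2 ∂haarStates ι =
      A / 2 + if w = w' then A / 2 else 0 := by
    intro w w'
    split_ifs with h
    · subst h; rw [hdiag]; ring
    · have := haarStates_integral_norm_pow_four h
      rw [hdiag] at this
      linarith
  have htot : ∑ w : ι, ∑ w' : ι, ∫ φ, ‖φ w‖ ^ 2 * ‖φ w'‖ ^ 2 ∂haarStates ι = 1 := by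
    have h1 : ∀ᵐ φ ∂haarStates ι, ∑ w : ι, ∑ w' : ι, ‖φ w‖ ^ 2 * ‖φ w'‖ ^ 2 = 1 := by
      filter_upwards [ae_haarStates_norm] with φ hφ
      simp_rw [← Finset.mul_sum, sum_norm_sq_eq_one hφ, mul_one, sum_norm_sq_eq_one hφ]
    have h2 := integral_congr_ae h1
    rw [integral_sum_sum fun w w' => by fun_prop] at h2
    rw [h2]; simp
  simp_rw [hoff, Finset.sum_add_distrib] at htot
  simp only [Finset.sum_const, Finset.card_univ, nsmul_eq_mul, Finset.sum_ite_eq, Finset.mem_univ,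
    if_true, ← hN] at htot
  have hA' : A = 2 / (N * (N + 1)) := by
    rw [eq_div_iff (by positivity)]; linarith
  rw [hoff, hA']
  split_ifs <;> ring

/-- The probability that measuring two copies of a Haar random state gives outcomes related
by `R`, for a reflexive relation `R` with `m` successors of each label. -/
theorem sum_outcomeProb_haarStates_ite [Nonempty ι] {t : ℕ} {i j : Fin t} (hij : i ≠ j)
    (R : ι → ι → Prop) [DecidableRel R] (hrefl : ∀ u, R u u) {m : ℕ}
    (hm : ∀ u, (Finset.univ.filter fun v => R u v).card = m) :
    ∑ x, (if R (x i) (x j) then outcomeProb t (haarStates ι) x else 0) =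
      (m + 1) / (Fintype.card ι + 1 : ℝ) := by
  have hN : (0 : ℝ) < Fintype.card ι := by exact_mod_cast Fintype.card_pos
  have h : ∀ u v, ∫ φ, (if R u v then ‖φ u‖ ^ 2 * ‖φ v‖ ^ 2 else 0) ∂haarStates ι =
      ((if R u v then 1 else 0) + if u = v then 1 else 0) /
        (Fintype.card ι * (Fintype.card ι + 1)) := by
    intro u v
    by_cases huv : u = v
    · subst huv
      simp only [if_pos (hrefl u), haarStates_integral_norm_sq_mul, if_true]
      norm_num
    · by_cases hR : R u v
      · simp [hR, huv, haarStates_integral_norm_sq_mul]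
      · simp [hR, huv]
  rw [sum_outcomeProb_ite ae_haarStates_norm hij,
    integral_sum_sum fun u v => by split_ifs <;> fun_prop]
  simp_rw [h, ← Finset.sum_div, Finset.sum_add_distrib, Finset.sum_boole, hm]
  simp [Finset.filter_eq]
  field_simp

end HaarFourth

/-! ### Orbits and ensembles under local permutation-and-phase unitaries -/

section Orbit

variable {α β : Type} [Fintype α] [Fintype β] [DecidableEq α] [DecidableEq β]

/-- A local permutation-and-phase unitary is a permutation-and-phase unitary. -/
theorem localPF_eq (pA : Equiv.Perm α) (pB : Equiv.Perm β) (fA : α → ℝ) (fB : β → ℝ) :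
    localPF pA pB fA fB =
      permOp (pA.prodCongr pB) * phaseOp fun z => fA z.1 + fB z.2 := by
  rw [localPF, Matrix.mul_kronecker_mul]
  congr 1
  · ext ⟨a, b⟩ ⟨a', b'⟩
    simp only [Matrix.kroneckerMap_apply, permOp, Matrix.of_apply, Equiv.prodCongr_apply,
      Prod.map_apply, Prod.mk.injEq]
    by_cases ha : a = pA a' <;> by_cases hb : b = pB b' <;> simp [ha, hb]
  · rw [phaseOp, phaseOp, Matrix.diagonal_kronecker_diagonal, phaseOp]
    congr 1
    ext z
    rw [← Complex.exp_add]
    congr 1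
    push_cast
    ring

theorem applyOp_localPF_apply (pA : Equiv.Perm α) (pB : Equiv.Perm β) (fA : α → ℝ) (fB : β → ℝ)
    (ψ : Ket (α × β)) (x : α × β) :
    applyOp (localPF pA pB fA fB) ψ x =
      Complex.exp (2 * Real.pi * Complex.I * (fA (pA⁻¹ x.1) : ℂ)) *
        Complex.exp (2 * Real.pi * Complex.I * (fB (pB⁻¹ x.2) : ℂ)) *
        ψ (pA⁻¹ x.1, pB⁻¹ x.2) := by
  rw [localPF_eq, applyOp_mul, applyOp_permOp_apply, applyOp_phaseOp_apply]
  rw [show (pA.prodCongr pB)⁻¹ x = (pA⁻¹ x.1, pB⁻¹ x.2) from rfl, ← Complex.exp_add]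
  congr 2
  push_cast
  ring

theorem norm_applyOp_localPF_apply (pA : Equiv.Perm α) (pB : Equiv.Perm β) (fA : α → ℝ)
    (fB : β → ℝ) (ψ : Ket (α × β)) (x : α × β) :
    ‖applyOp (localPF pA pB fA fB) ψ x‖ = ‖ψ (pA⁻¹ x.1, pB⁻¹ x.2)‖ := by
  rw [applyOp_localPF_apply, norm_mul, norm_mul, norm_exp_phase, norm_exp_phase, one_mul, one_mul]

theorem norm_applyOp_localPF (pA : Equiv.Perm α) (pB : Equiv.Perm β) (fA : α → ℝ)
    (fB : β → ℝ) (ψ : Ket (α × β)) : ‖applyOp (localPF pA pB fA fB) ψ‖ = ‖ψ‖ := by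
  rw [localPF_eq]
  exact norm_applyOp (mul_mem (permOp_mem_unitaryGroup _) (phaseOp_mem_unitaryGroup _)) ψ

theorem continuous_applyOp_localPF (pA : Equiv.Perm α) (pB : Equiv.Perm β) (ψ : Ket (α × β)) :
    Continuous fun f : (α → ℝ) × (β → ℝ) => applyOp (localPF pA pB f.1 f.2) ψ := by
  have h : Continuous fun (f : (α → ℝ) × (β → ℝ)) (x : α × β) =>
      applyOp (localPF pA pB f.1 f.2) ψ x := by
    refine continuous_pi fun x => ?_
    simp_rw [applyOp_localPF_apply]
    fun_prop
  exact (PiLp.continuous_toLp 2 _).comp h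

instance isProbabilityMeasure_uniformPhases (ι : Type) [Fintype ι] :
    IsProbabilityMeasure (uniformPhases ι) := by
  have : IsProbabilityMeasure (volume.restrict (Set.Ico (0 : ℝ) 1)) := ⟨by simp⟩
  unfold uniformPhases
  infer_instance

instance isProbabilityMeasure_localPFEnsemble (ψ : Ket (α × β)) :
    IsProbabilityMeasure (localPFEnsemble ψ) := by
  constructor
  have h : ∀ pA : Equiv.Perm α, ∀ pB : Equiv.Perm β,
      ((uniformPhases α).prod (uniformPhases β)).map
        (fun f => applyOp (localPF pA pB f.1 f.2) ψ) Set.univ = 1 := fun pA pB => by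
    rw [Measure.map_apply (continuous_applyOp_localPF pA pB ψ).measurable .univ]
    simp
  simp only [localPFEnsemble, Measure.smul_apply, Measure.finsetSum_apply, h, smul_eq_mul,
    Finset.sum_const, Finset.card_univ, nsmul_eq_mul, mul_one]
  rw [Nat.cast_mul]
  refine ENNReal.inv_mul_cancel ?_ ?_
  · simp [Fintype.card_ne_zero]
  · exact ENNReal.mul_ne_top (ENNReal.natCast_ne_top _) (ENNReal.natCast_ne_top _)

theorem integral_localPFEnsemble {E : Type*} [NormedAddCommGroup E] [NormedSpace ℝ E]
    [SecondCountableTopology E] [CompleteSpace E]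
    {ψ : Ket (α × β)} (hψ : ‖ψ‖ = 1) {F : Ket (α × β) → E} (hF : Continuous F) :
    ∫ φ, F φ ∂localPFEnsemble ψ =
      ((Fintype.card (Equiv.Perm α) * Fintype.card (Equiv.Perm β) : ℕ) : ℝ)⁻¹ •
        ∑ pA : Equiv.Perm α, ∑ pB : Equiv.Perm β,
          ∫ f, F (applyOp (localPF pA pB f.1 f.2) ψ)
            ∂((uniformPhases α).prod (uniformPhases β)) := by
  have hm : ∀ pA pB, AEMeasurable (fun f : (α → ℝ) × (β → ℝ) => applyOp (localPF pA pB f.1 f.2) ψ)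
      ((uniformPhases α).prod (uniformPhases β)) := fun pA pB =>
    (continuous_applyOp_localPF pA pB ψ).measurable.aemeasurable
  have hi : ∀ pA pB, Integrable F (((uniformPhases α).prod (uniformPhases β)).map
      fun f => applyOp (localPF pA pB f.1 f.2) ψ) := fun pA pB => by
    refine integrable_of_continuous ?_ hF
    rw [ae_map_iff (hm pA pB) (measurableSet_eq_fun measurable_norm measurable_const)]
    exact ae_of_all _ fun f => by rw [norm_applyOp_localPF, hψ]
  rw [localPFEnsemble, integral_smul_measure, integral_finsetSum_measure fun pA _ =>
    integrable_finsetSum_measure.mpr fun pB _ => hi pA pB]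
  congr 1
  · simp
  · refine Finset.sum_congr rfl fun pA _ => ?_
    rw [integral_finsetSum_measure fun pB _ => hi pA pB]
    refine Finset.sum_congr rfl fun pB _ => ?_
    exact integral_map (hm pA pB) hF.aestronglyMeasurable

theorem ae_localPFEnsemble {ψ : Ket (α × β)} {P : Ket (α × β) → Prop}
    (hP : MeasurableSet {φ | P φ})
    (h : ∀ pA pB fA fB, P (applyOp (localPF pA pB fA fB) ψ)) :
    ∀ᵐ φ ∂localPFEnsemble ψ, P φ := by
  refine Measure.ae_smul_measure ?_ _
  simp only [← Measure.sum_fintype, Measure.ae_sum_iff]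
  intro pA pB
  rw [ae_map_iff (continuous_applyOp_localPF pA pB ψ).measurable.aemeasurable hP]
  exact ae_of_all _ fun f => h pA pB f.1 f.2

theorem ae_localPFEnsemble_norm {ψ : Ket (α × β)} (hψ : ‖ψ‖ = 1) :
    ∀ᵐ φ ∂localPFEnsemble ψ, ‖φ‖ = 1 :=
  ae_localPFEnsemble (measurableSet_eq_fun measurable_norm measurable_const)
    fun pA pB fA fB => by rw [norm_applyOp_localPF, hψ]

theorem outcomeProb_localPFEnsemble {t : ℕ} {ψ : Ket (α × β)} (hψ : ‖ψ‖ = 1)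
    (x : Fin t → α × β) :
    outcomeProb t (localPFEnsemble ψ) x =
      ((Fintype.card (Equiv.Perm α) * Fintype.card (Equiv.Perm β) : ℕ) : ℝ)⁻¹ *
        ∑ pA : Equiv.Perm α, ∑ pB : Equiv.Perm β,
          ∏ i, ‖ψ (pA⁻¹ (x i).1, pB⁻¹ (x i).2)‖ ^ 2 := by
  rw [outcomeProb, integral_localPFEnsemble hψ (by fun_prop)]
  simp [norm_applyOp_localPF_apply]

theorem outcomeProb_localPFEnsemble_perm {t : ℕ} {ψ : Ket (α × β)} (hψ : ‖ψ‖ = 1)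
    (x : Fin t → α × β) (gA : Equiv.Perm α) (gB : Equiv.Perm β) :
    outcomeProb t (localPFEnsemble ψ) (gA.prodCongr gB ∘ x) =
      outcomeProb t (localPFEnsemble ψ) x := by
  rw [outcomeProb_localPFEnsemble hψ, outcomeProb_localPFEnsemble hψ]
  congr 1
  rw [← Equiv.sum_comp (Equiv.mulLeft gA)]
  refine Finset.sum_congr rfl fun pA _ => ?_
  rw [← Equiv.sum_comp (Equiv.mulLeft gB)]
  refine Finset.sum_congr rfl fun pB _ => ?_
  simp only [Function.comp_apply, Equiv.prodCongr_apply, Prod.map, Equiv.coe_mulLeft, mul_inv_rev,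
    Equiv.Perm.mul_apply]
  simp

/-- A nontrivial character of the torus has mean zero. -/
theorem integral_uniformPhases_exp {ι : Type} [Fintype ι] (m : ι → ℤ) (hm : m ≠ 0) :
    ∫ f, Complex.exp (2 * Real.pi * Complex.I * ∑ z, (m z : ℂ) * (f z : ℂ)) ∂uniformPhases ι
      = 0 := by
  have h : ∀ f : ι → ℝ, Complex.exp (2 * Real.pi * Complex.I * ∑ z, (m z : ℂ) * (f z : ℂ)) =
      ∏ z, Complex.exp (2 * Real.pi * Complex.I * (m z : ℂ) * (f z : ℂ)) := fun f => by
    rw [← Complex.exp_sum, Finset.mul_sum]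
    simp only [mul_assoc]
  simp_rw [h]
  rw [uniformPhases, integral_fintype_prod_eq_prod
    (fun z (r : ℝ) => Complex.exp (2 * Real.pi * Complex.I * (m z : ℂ) * (r : ℂ)))]
  obtain ⟨z, hz⟩ := Function.ne_iff.mp hm
  refine Finset.prod_eq_zero (Finset.mem_univ z) ?_
  rw [integral_Ico_eq_integral_Ioc, ← intervalIntegral.integral_of_le zero_le_one]
  have hc : 2 * (Real.pi : ℂ) * Complex.I * (m z : ℂ) ≠ 0 :=
    mul_ne_zero Complex.two_pi_I_ne_zero (by exact_mod_cast hz)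
  rw [integral_exp_mul_complex hc]
  have : Complex.exp (2 * (Real.pi : ℂ) * Complex.I * (m z : ℂ) * ((1 : ℝ) : ℂ)) = 1 := by
    rw [Complex.exp_eq_one_iff]
    exact ⟨m z, by push_cast; ring⟩
  rw [this]
  simp

end Orbit

/-! ### Collision probabilities and the design error -/

section Matching

variable {α β : Type} [DecidableEq α] [DecidableEq β]

/-- For tuples in a set `S` of pairs on which the first label determines the second, the occupation
numbers of the first labels, here relabelled by `e`, determine those of the pairs. -/
theorem occupation_eq_of_occupation_fst_eq {γ : Type} [DecidableEq γ] {t : ℕ}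
    {S : α × β → Prop}
    (hS : ∀ a b b', S (a, b) → S (a, b') → b = b') {x y : Fin t → α × β}
    (hx : ∀ i, S (x i)) (hy : ∀ i, S (y i)) (e : α ≃ γ)
    (h : occupation (fun i => e (x i).1) = occupation fun i => e (y i).1) :
    occupation x = occupation y := by
  have key : ∀ z : Fin t → α × β, (∀ i, S (z i)) → ∀ a b, S (a, b) →
      occupation z (a, b) = occupation (fun i => e (z i).1) (e a) := by
    intro z hz a b hab
    unfold occupation
    congr 1
    ext i
    simp only [Finset.mem_filter, Finset.mem_univ, true_and, EmbeddingLike.apply_eq_iff_eq]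
    constructor
    · intro h; rw [h]
    · rintro rfl
      exact Prod.ext rfl (hS _ _ _ (hz i) hab)
  ext ⟨a, b⟩
  by_cases hab : S (a, b)
  · rw [key x hx a b hab, key y hy a b hab, h]
  · have hzero : ∀ z : Fin t → α × β, (∀ i, S (z i)) → occupation z (a, b) = 0 := by
      intro z hz
      simp only [occupation, Finset.card_eq_zero, Finset.filter_eq_empty_iff, Finset.mem_univ,
        forall_const]
      intro i hi
      exact hab (hi ▸ hz i)
    rw [hzero x hx, hzero y hy]

variable [Fintype α] [Fintype β]

theorem tensorPow_applyOp_localPF {t : ℕ} (pA : Equiv.Perm α) (pB : Equiv.Perm β) (fA : α → ℝ)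
    (fB : β → ℝ) (ψ : Ket (α × β)) (x : Fin t → α × β) :
    tensorPow t (applyOp (localPF pA pB fA fB) ψ) x =
      Complex.exp (2 * Real.pi * Complex.I *
        ∑ z, (occupation (fun i => pA⁻¹ (x i).1) z : ℂ) * (fA z : ℂ)) *
      ∏ i, (Complex.exp (2 * Real.pi * Complex.I * (fB (pB⁻¹ (x i).2) : ℂ)) *
        ψ (pA⁻¹ (x i).1, pB⁻¹ (x i).2)) := by
  simp only [tensorPow, applyOp_localPF_apply, mul_assoc, Finset.prod_mul_distrib]
  congr 1
  rw [prod_comp_eq_prod_pow_occupation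
    (fun a => Complex.exp (2 * ((Real.pi : ℂ) * (Complex.I * (fA a : ℂ)))))]
  simp_rw [← Complex.exp_nat_mul, ← Complex.exp_sum, Finset.mul_sum]
  congr 1
  refine Finset.sum_congr rfl fun z _ => ?_
  ring

/-- If in the support of `ψ` the label on `A` determines the label on `B`, then averaging over the
phases on `A` alone removes every entry of the moment between tuples with different occupation
numbers. -/
theorem moment_localPFEnsemble (t : ℕ) {ψ : Ket (α × β)} (hψ : ‖ψ‖ = 1)
    (hA : ∀ a b b', ψ (a, b) ≠ 0 → ψ (a, b') ≠ 0 → b = b') :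
    moment t (localPFEnsemble ψ) =
      fibreMatrix occupation (outcomeProb t (localPFEnsemble ψ)) := by
  refine moment_eq_fibreMatrix fun x y hxy => ?_
  rw [integral_localPFEnsemble hψ (by
    unfold tensorPow
    exact Continuous.mul (by fun_prop) (Complex.continuous_conj.comp (by fun_prop)))]
  rw [Finset.sum_eq_zero fun pA _ => Finset.sum_eq_zero fun pB _ => ?_, smul_zero]
  have hvanish : ∀ z : Fin t → α × β, (¬ ∀ i, ψ (pA⁻¹ (z i).1, pB⁻¹ (z i).2) ≠ 0) →
      ∀ fA fB, tensorPow t (applyOp (localPF pA pB fA fB) ψ) z = 0 := by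
    intro z hz fA fB
    push Not at hz
    obtain ⟨i, hi⟩ := hz
    rw [tensorPow_applyOp_localPF, Finset.prod_eq_zero (Finset.mem_univ i) (by rw [hi, mul_zero]),
      mul_zero]
  by_cases hx : ∀ i, ψ (pA⁻¹ (x i).1, pB⁻¹ (x i).2) ≠ 0
  swap
  · simp [hvanish x hx]
  by_cases hy : ∀ i, ψ (pA⁻¹ (y i).1, pB⁻¹ (y i).2) ≠ 0
  swap
  · simp [hvanish y hy]
  set m : α → ℤ := fun z => (occupation (fun i => pA⁻¹ (x i).1) z : ℤ) -
    occupation (fun i => pA⁻¹ (y i).1) z with hm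
  have hm0 : m ≠ 0 := by
    intro h0
    refine hxy (occupation_eq_of_occupation_fst_eq
      (S := fun u => ψ (pA⁻¹ u.1, pB⁻¹ u.2) ≠ 0) ?_ hx hy pA⁻¹ ?_)
    · intro a b b' h h'
      exact pB⁻¹.injective (hA _ _ _ h h')
    · ext z
      have := congrFun h0 z
      simp only [hm, Pi.zero_apply, sub_eq_zero] at this
      exact_mod_cast this
  have hsplit : ∀ f : (α → ℝ) × (β → ℝ),
      tensorPow t (applyOp (localPF pA pB f.1 f.2) ψ) x *
        conj (tensorPow t (applyOp (localPF pA pB f.1 f.2) ψ) y) =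
      Complex.exp (2 * Real.pi * Complex.I * ∑ z, (m z : ℂ) * (f.1 z : ℂ)) *
      ((∏ i, (Complex.exp (2 * Real.pi * Complex.I * (f.2 (pB⁻¹ (x i).2) : ℂ)) *
        ψ (pA⁻¹ (x i).1, pB⁻¹ (x i).2))) *
      conj (∏ i, (Complex.exp (2 * Real.pi * Complex.I * (f.2 (pB⁻¹ (y i).2) : ℂ)) *
        ψ (pA⁻¹ (y i).1, pB⁻¹ (y i).2)))) := by
    intro f
    rw [tensorPow_applyOp_localPF, tensorPow_applyOp_localPF, map_mul, ← Complex.exp_conj,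
      mul_mul_mul_comm, ← Complex.exp_add]
    congr 2
    simp only [map_mul, map_sum, Complex.conj_ofReal, Complex.conj_I, map_ofNat, map_natCast, hm]
    push_cast
    simp_rw [sub_mul, Finset.sum_sub_distrib]
    ring
  simp_rw [hsplit]
  refine (integral_prod_mul
    (fun fA : α → ℝ => Complex.exp (2 * Real.pi * Complex.I * ∑ z, (m z : ℂ) * (fA z : ℂ)))
    (fun fB : β → ℝ =>
      (∏ i, (Complex.exp (2 * Real.pi * Complex.I * (fB (pB⁻¹ (x i).2) : ℂ)) *
        ψ (pA⁻¹ (x i).1, pB⁻¹ (x i).2))) *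
      conj (∏ i, (Complex.exp (2 * Real.pi * Complex.I * (fB (pB⁻¹ (y i).2) : ℂ)) *
        ψ (pA⁻¹ (y i).1, pB⁻¹ (y i).2))))).trans ?_
  rw [integral_uniformPhases_exp m hm0, zero_mul]

theorem sum_outcomeProb_localPFEnsemble_ite {t : ℕ} {ψ : Ket (α × β)} (hψ : ‖ψ‖ = 1)
    {i j : Fin t} (hij : i ≠ j) (R : α × β → α × β → Prop) [DecidableRel R]
    (hR : ∀ (gA : Equiv.Perm α) (gB : Equiv.Perm β) u v,
      R (gA.prodCongr gB u) (gA.prodCongr gB v) ↔ R u v) :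
    ∑ x, (if R (x i) (x j) then outcomeProb t (localPFEnsemble ψ) x else 0) =
      ∑ u, ∑ v, if R u v then ‖ψ u‖ ^ 2 * ‖ψ v‖ ^ 2 else 0 := by
  rw [sum_outcomeProb_ite (ae_localPFEnsemble_norm hψ) hij]
  have hcont : Continuous fun φ : Ket (α × β) =>
      ∑ u, ∑ v, if R u v then ‖φ u‖ ^ 2 * ‖φ v‖ ^ 2 else 0 :=
    continuous_finsetSum _ fun u _ => continuous_finsetSum _ fun v _ => by
      split_ifs <;> fun_prop
  have hconst : ∀ᵐ φ ∂localPFEnsemble ψ,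
      (∑ u, ∑ v, if R u v then ‖φ u‖ ^ 2 * ‖φ v‖ ^ 2 else 0) =
        ∑ u, ∑ v, if R u v then ‖ψ u‖ ^ 2 * ‖ψ v‖ ^ 2 else 0 := by
    refine ae_localPFEnsemble (measurableSet_eq_fun hcont.measurable measurable_const)
      fun pA pB fA fB => ?_
    rw [← Equiv.sum_comp (pA.prodCongr pB)]
    refine Finset.sum_congr rfl fun u _ => ?_
    rw [← Equiv.sum_comp (pA.prodCongr pB)]
    refine Finset.sum_congr rfl fun v _ => ?_
    simp only [hR, norm_applyOp_localPF_apply]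
    simp
  rw [integral_congr_ae hconst]
  simp

/-- If all nonzero amplitudes have squared modulus `1 / K`, a relation that is equality on the
support has probability `1 / K`. -/
theorem sum_sum_ite_eq_of_flat {ι : Type} [Fintype ι] {ψ : Ket ι} (hψ : ‖ψ‖ = 1) {K : ℝ}
    (hflat : ∀ u, ψ u ≠ 0 → ‖ψ u‖ ^ 2 = 1 / K) (R : ι → ι → Prop) [DecidableRel R]
    (hrefl : ∀ u, R u u) (hR : ∀ u v, ψ u ≠ 0 → ψ v ≠ 0 → R u v → u = v) :
    (∑ u, ∑ v, if R u v then ‖ψ u‖ ^ 2 * ‖ψ v‖ ^ 2 else 0) = 1 / K := by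
  have h : ∀ u, (∑ v, if R u v then ‖ψ u‖ ^ 2 * ‖ψ v‖ ^ 2 else 0) = ‖ψ u‖ ^ 2 * (1 / K) := by
    intro u
    by_cases hu : ψ u = 0
    · simp [hu]
    · rw [Finset.sum_eq_single u]
      · rw [if_pos (hrefl u), hflat u hu]
      · intro v _ hv
        split_ifs with huv
        · by_cases hv0 : ψ v = 0
          · simp [hv0]
          · exact absurd (hR u v hu hv0 huv).symm hv
        · rfl
      · simp
  simp_rw [h, ← Finset.sum_mul, sum_norm_sq_eq_one hψ, one_mul]

/-- The tuples of pairs of labels in which the labels on `A` are distinct and the labels on `B` are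
distinct. -/
def locallyDistinct (t : ℕ) (α β : Type) [Fintype α] [Fintype β] [DecidableEq α]
    [DecidableEq β] : Finset (Fin t → α × β) :=
  Finset.univ.filter fun x =>
    (Function.Injective fun i => (x i).1) ∧ Function.Injective fun i => (x i).2

/-- Local permutations act transitively on the tuples with distinct labels on `A` and on `B`. -/
theorem exists_perm_of_mem_locallyDistinct {t : ℕ} {x y : Fin t → α × β}
    (hx : x ∈ locallyDistinct t α β) (hy : y ∈ locallyDistinct t α β) :
    ∃ (gA : Equiv.Perm α) (gB : Equiv.Perm β), y = gA.prodCongr gB ∘ x := by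
  simp only [locallyDistinct, Finset.mem_filter, Finset.mem_univ, true_and] at hx hy
  obtain ⟨gA, hgA⟩ := Equiv.Perm.exists_extending_pair _ _ hx.1 hy.1
  obtain ⟨gB, hgB⟩ := Equiv.Perm.exists_extending_pair _ _ hx.2 hy.2
  refine ⟨gA, gB, ?_⟩
  ext i
  · exact (hgA i).symm
  · exact (hgB i).symm

/-- Union bound over the pairs of positions at which labels may collide. -/
theorem sum_compl_locallyDistinct_le {t : ℕ} {p : (Fin t → α × β) → ℝ} (hp : ∀ x, 0 ≤ p x)
    {c : ℝ} (hc : 0 ≤ c)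
    (h₁ : ∀ i j, i ≠ j → ∑ x, (if (x i).1 = (x j).1 then p x else 0) ≤ c)
    (h₂ : ∀ i j, i ≠ j → ∑ x, (if (x i).2 = (x j).2 then p x else 0) ≤ c) :
    ∑ x ∈ (locallyDistinct t α β)ᶜ, p x ≤ (t : ℝ) ^ 2 * (2 * c) := by
  let F : (Fin t → α × β) → Fin t → Fin t → ℝ := fun x i j =>
    if i = j then 0 else
      (if (x i).1 = (x j).1 then p x else 0) + (if (x i).2 = (x j).2 then p x else 0)
  have hF : ∀ x i j, 0 ≤ F x i j := by
    intro x i j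
    have := hp x
    simp only [F]
    split_ifs <;> linarith
  have hle : ∀ x ∈ (locallyDistinct t α β)ᶜ, p x ≤ ∑ i, ∑ j, F x i j := by
    intro x hx
    have hex : ∃ i j, i ≠ j ∧ ((x i).1 = (x j).1 ∨ (x i).2 = (x j).2) := by
      rw [locallyDistinct, Finset.mem_compl, Finset.mem_filter] at hx
      simp only [Finset.mem_univ, true_and, not_and_or, Function.not_injective_iff] at hx
      rcases hx with ⟨i, j, h, hij⟩ | ⟨i, j, h, hij⟩
      · exact ⟨i, j, hij, Or.inl h⟩
      · exact ⟨i, j, hij, Or.inr h⟩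
    obtain ⟨i, j, hij, h⟩ := hex
    calc p x ≤ F x i j := by
          have := hp x
          simp only [F, if_neg hij]
          rcases h with h | h <;> rw [if_pos h] <;> split_ifs <;> linarith
      _ ≤ ∑ j, F x i j :=
          Finset.single_le_sum (f := fun j => F x i j) (fun j _ => hF x i j) (Finset.mem_univ j)
      _ ≤ ∑ i, ∑ j, F x i j :=
          Finset.single_le_sum (f := fun i => ∑ j, F x i j)
            (fun i _ => Finset.sum_nonneg fun j _ => hF x i j) (Finset.mem_univ i)
  calc ∑ x ∈ (locallyDistinct t α β)ᶜ, p x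
      ≤ ∑ x ∈ (locallyDistinct t α β)ᶜ, ∑ i, ∑ j, F x i j := Finset.sum_le_sum hle
    _ ≤ ∑ x, ∑ i, ∑ j, F x i j :=
        Finset.sum_le_sum_of_subset_of_nonneg (Finset.subset_univ _) fun x _ _ =>
          Finset.sum_nonneg fun i _ => Finset.sum_nonneg fun j _ => hF x i j
    _ = ∑ i, ∑ j, ∑ x, F x i j := by
        rw [Finset.sum_comm]
        exact Finset.sum_congr rfl fun i _ => Finset.sum_comm
    _ ≤ ∑ _i : Fin t, ∑ _j : Fin t, 2 * c := by
        refine Finset.sum_le_sum fun i _ => Finset.sum_le_sum fun j _ => ?_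
        by_cases hij : i = j
        · simp [F, hij, hc]
        · simp only [F, if_neg hij, Finset.sum_add_distrib]
          linarith [h₁ i j hij, h₂ i j hij]
    _ = (t : ℝ) ^ 2 * (2 * c) := by simp; ring

theorem sum_outcomeProb_haarStates_fst_le [Nonempty α] [Nonempty β] {t : ℕ} {i j : Fin t}
    (hij : i ≠ j) :
    ∑ x : Fin t → α × β, (if (x i).1 = (x j).1 then outcomeProb t (haarStates (α × β)) x else 0)
      ≤ 2 / Fintype.card α := by
  have hcard : ∀ u : α × β, (Finset.univ.filter fun v : α × β => u.1 = v.1).card =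
      Fintype.card β := fun u => by
    rw [show (Finset.univ.filter fun v : α × β => u.1 = v.1) = {u.1} ×ˢ Finset.univ by
      ext v; rw [Finset.mem_product]; simp [eq_comm]]
    simp
  rw [sum_outcomeProb_haarStates_ite hij (fun u v : α × β => u.1 = v.1) (fun _ => rfl) hcard,
    Fintype.card_prod]
  have ha : (1 : ℝ) ≤ Fintype.card α := by exact_mod_cast Fintype.card_pos
  have hb : (1 : ℝ) ≤ Fintype.card β := by exact_mod_cast Fintype.card_pos
  push_cast
  rw [div_le_div_iff₀ (by positivity) (by positivity)]
  nlinarith [mul_le_mul_of_nonneg_left hb (zero_le_one.trans ha)]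

theorem sum_outcomeProb_haarStates_snd_le [Nonempty α] [Nonempty β] {t : ℕ} {i j : Fin t}
    (hij : i ≠ j) :
    ∑ x : Fin t → α × β, (if (x i).2 = (x j).2 then outcomeProb t (haarStates (α × β)) x else 0)
      ≤ 2 / Fintype.card β := by
  have hcard : ∀ u : α × β, (Finset.univ.filter fun v : α × β => u.2 = v.2).card =
      Fintype.card α := fun u => by
    rw [show (Finset.univ.filter fun v : α × β => u.2 = v.2) = Finset.univ ×ˢ {u.2} by
      ext v; rw [Finset.mem_product]; simp [eq_comm]]
    simp
  rw [sum_outcomeProb_haarStates_ite hij (fun u v : α × β => u.2 = v.2) (fun _ => rfl) hcard,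
    Fintype.card_prod]
  have ha : (1 : ℝ) ≤ Fintype.card α := by exact_mod_cast Fintype.card_pos
  have hb : (1 : ℝ) ≤ Fintype.card β := by exact_mod_cast Fintype.card_pos
  push_cast
  rw [div_le_div_iff₀ (by positivity) (by positivity)]
  nlinarith [mul_le_mul_of_nonneg_left ha (zero_le_one.trans hb)]

/-- A state with `K` nonzero amplitudes of equal modulus, no two of which share the label on `A` or
the label on `B`. -/
structure IsFlatMatching (ψ : Ket (α × β)) (K : ℝ) : Prop where
  norm_eq_one : ‖ψ‖ = 1
  norm_sq_eq : ∀ u, ψ u ≠ 0 → ‖ψ u‖ ^ 2 = 1 / K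
  snd_unique : ∀ a b b', ψ (a, b) ≠ 0 → ψ (a, b') ≠ 0 → b = b'
  fst_unique : ∀ a a' b, ψ (a, b) ≠ 0 → ψ (a', b) ≠ 0 → a = a'

namespace IsFlatMatching

variable {ψ : Ket (α × β)} {K : ℝ} {t : ℕ}

theorem designError_eq (h : IsFlatMatching ψ K) :
    designError t (localPFEnsemble ψ) =
      (∑ x, |outcomeProb t (localPFEnsemble ψ) x - outcomeProb t (haarStates (α × β)) x|) / 2 :=
  designError_eq_sum (moment_localPFEnsemble t h.norm_eq_one h.snd_unique) (moment_haarStates t)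

theorem sum_outcomeProb_fst (h : IsFlatMatching ψ K) {i j : Fin t} (hij : i ≠ j) :
    ∑ x, (if (x i).1 = (x j).1 then outcomeProb t (localPFEnsemble ψ) x else 0) = 1 / K := by
  rw [sum_outcomeProb_localPFEnsemble_ite h.norm_eq_one hij (fun u v => u.1 = v.1) (by simp)]
  refine sum_sum_ite_eq_of_flat h.norm_eq_one h.norm_sq_eq _ (fun _ => rfl) ?_
  rintro ⟨a, b⟩ ⟨a', b'⟩ hu hv rfl
  exact Prod.ext rfl (h.snd_unique _ _ _ hu hv)

theorem sum_outcomeProb_snd (h : IsFlatMatching ψ K) {i j : Fin t} (hij : i ≠ j) :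
    ∑ x, (if (x i).2 = (x j).2 then outcomeProb t (localPFEnsemble ψ) x else 0) = 1 / K := by
  rw [sum_outcomeProb_localPFEnsemble_ite h.norm_eq_one hij (fun u v => u.2 = v.2) (by simp)]
  refine sum_sum_ite_eq_of_flat h.norm_eq_one h.norm_sq_eq _ (fun _ => rfl) ?_
  rintro ⟨a, b⟩ ⟨a', b'⟩ hu hv rfl
  exact Prod.ext (h.fst_unique _ _ _ hu hv) rfl

theorem sum_outcomeProb_eq (h : IsFlatMatching ψ K) {i j : Fin t} (hij : i ≠ j) :
    ∑ x, (if x i = x j then outcomeProb t (localPFEnsemble ψ) x else 0) = 1 / K := by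
  rw [sum_outcomeProb_localPFEnsemble_ite h.norm_eq_one hij (fun u v => u = v)
    (fun _ _ _ _ => EmbeddingLike.apply_eq_iff_eq _)]
  exact sum_sum_ite_eq_of_flat h.norm_eq_one h.norm_sq_eq _ (fun _ => rfl) fun _ _ _ _ h => h

/-- Conditioned on local distinctness, measuring `t` copies gives the same uniform distribution for
the ensemble and for Haar random states, and local distinctness fails with probability
`O(t ^ 2 / K)` for both. -/
theorem designError_le [Nonempty α] [Nonempty β] (h : IsFlatMatching ψ K) (hK : 0 < K)
    (hα : K ≤ Fintype.card α) (hβ : K ≤ Fintype.card β) :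
    designError t (localPFEnsemble ψ) ≤ 6 * (t : ℝ) ^ 2 / K := by
  have hE := sum_compl_locallyDistinct_le (t := t) (outcomeProb_nonneg (localPFEnsemble ψ))
    (one_div_nonneg.mpr hK.le) (fun i j hij => (h.sum_outcomeProb_fst hij).le)
    (fun i j hij => (h.sum_outcomeProb_snd hij).le)
  have hH := sum_compl_locallyDistinct_le (t := t) (outcomeProb_nonneg (haarStates (α × β)))
    (c := 2 / K) (by positivity)
    (fun i j hij => (sum_outcomeProb_haarStates_fst_le hij).trans (by gcongr))
    (fun i j hij => (sum_outcomeProb_haarStates_snd_le hij).trans (by gcongr))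
  have htv := sum_abs_sub_le_of_const_on (outcomeProb_nonneg (localPFEnsemble ψ))
    (outcomeProb_nonneg (haarStates (α × β)))
    (sum_outcomeProb (t := t) (ae_localPFEnsemble_norm h.norm_eq_one))
    (sum_outcomeProb ae_haarStates_norm) (locallyDistinct t α β)
    (fun x hx y hy => by
      obtain ⟨gA, gB, rfl⟩ := exists_perm_of_mem_locallyDistinct hx hy
      exact (outcomeProb_localPFEnsemble_perm h.norm_eq_one x gA gB).symm)
    (fun x hx y hy => by
      obtain ⟨gA, gB, rfl⟩ := exists_perm_of_mem_locallyDistinct hx hy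
      exact (outcomeProb_haarStates_perm _ x).symm)
  rw [h.designError_eq]
  have : 6 * (t : ℝ) ^ 2 / K =
      (2 * ((t : ℝ) ^ 2 * (2 * (1 / K)) + (t : ℝ) ^ 2 * (2 * (2 / K)))) / 2 := by ring
  rw [this]
  gcongr
  linarith

/-- The event that the first two outcomes coincide distinguishes the ensemble from Haar random
states. -/
theorem le_designError [Nonempty α] [Nonempty β] (h : IsFlatMatching ψ K) (ht : 2 ≤ t) :
    (1 / K - 2 / (Fintype.card α * Fintype.card β + 1)) / 2 ≤
      designError t (localPFEnsemble ψ) := by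
  have hij : (⟨0, by omega⟩ : Fin t) ≠ ⟨1, by omega⟩ := by simp
  have hE := h.sum_outcomeProb_eq hij
  have hH := sum_outcomeProb_haarStates_ite (ι := α × β) hij (fun u v => u = v) (fun _ => rfl)
    (m := 1) (fun u => by simp [Finset.filter_eq])
  rw [Fintype.card_prod] at hH
  rw [h.designError_eq]
  gcongr
  have : (1 / K - 2 / (Fintype.card α * Fintype.card β + 1) : ℝ) = 1 / K -
      (((1 : ℕ) : ℝ) + 1) / (((Fintype.card α * Fintype.card β : ℕ) : ℝ) + 1) := by
    push_cast; norm_num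
  rw [this, ← hE, ← hH, ← Finset.sum_sub_distrib]
  refine Finset.sum_le_sum fun x _ => ?_
  split_ifs
  · exact le_abs_self _
  · simp

end IsFlatMatching

end Matching

/-! ### Purity of the reduced density matrix -/

section Purity

variable {α β : Type} [Fintype α] [Fintype β]

theorem reducedA_trace_sq (φ : Ket (α × β)) :
    (reducedA φ * reducedA φ).trace.re = ∑ a, ∑ a', ‖reducedA φ a a'‖ ^ 2 := by
  have hconj : ∀ a a', reducedA φ a' a = conj (reducedA φ a a') := fun a a' => by
    simp only [reducedA, Matrix.of_apply, map_sum, map_mul, Complex.conj_conj]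
    exact Finset.sum_congr rfl fun b _ => mul_comm _ _
  simp only [Matrix.trace, Matrix.diag_apply, Matrix.mul_apply, Complex.re_sum]
  refine Finset.sum_congr rfl fun a _ => Finset.sum_congr rfl fun a' _ => ?_
  rw [hconj a a', Complex.mul_conj, Complex.ofReal_re, Complex.normSq_eq_norm_sq]

theorem reducedA_apply_self (φ : Ket (α × β)) (a : α) :
    reducedA φ a a = ((∑ b, ‖φ (a, b)‖ ^ 2 : ℝ) : ℂ) := by
  simp only [reducedA, Matrix.of_apply, Complex.mul_conj, Complex.normSq_eq_norm_sq]
  push_cast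
  rfl

theorem norm_sq_reducedA_apply_self (φ : Ket (α × β)) (a : α) :
    ‖reducedA φ a a‖ ^ 2 = (∑ b, ‖φ (a, b)‖ ^ 2) ^ 2 := by
  rw [reducedA_apply_self, Complex.norm_real, Real.norm_eq_abs, sq_abs]

/-- The purity of the reduced density matrix is invariant under local unitary operators. -/
theorem reducedA_trace_sq_applyOp_kronecker [DecidableEq α] [DecidableEq β] {U : Matrix α α ℂ}
    (hU : U ∈ Matrix.unitaryGroup α ℂ) {V : Matrix β β ℂ} (hV : V ∈ Matrix.unitaryGroup β ℂ)
    (ψ : Ket (α × β)) :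
    (reducedA (applyOp (U ⊗ₖ V) ψ) * reducedA (applyOp (U ⊗ₖ V) ψ)).trace =
      (reducedA ψ * reducedA ψ).trace := by
  let coeff : Ket (α × β) → Matrix α β ℂ := fun φ => Matrix.of fun a b => φ (a, b)
  have hred : ∀ φ, reducedA φ = coeff φ * (coeff φ).conjTranspose := fun φ => by
    ext a a'
    simp [reducedA, coeff, Matrix.mul_apply]
  have hcoeff : coeff (applyOp (U ⊗ₖ V) ψ) = U * coeff ψ * V.transpose := by
    ext a b
    simp only [coeff, applyOp, Matrix.of_apply, Matrix.mulVec, dotProduct,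
      Matrix.kroneckerMap_apply, Matrix.mul_apply, Matrix.transpose_apply, Fintype.sum_prod_type,
      Finset.sum_mul]
    rw [Finset.sum_comm]
    exact Finset.sum_congr rfl fun _ _ => Finset.sum_congr rfl fun _ _ => by ring
  have hU' : U.conjTranspose * U = 1 := Matrix.mem_unitaryGroup_iff'.mp hU
  have hV' : V.transpose * V.transpose.conjTranspose = 1 := by
    have h : V.conjTranspose * V = 1 := Matrix.mem_unitaryGroup_iff'.mp hV
    have h' : V.transpose * V.transpose.conjTranspose = (V.conjTranspose * V).transpose := by
      rw [Matrix.transpose_mul]; rfl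
    rw [h', h, Matrix.transpose_one]
  have h : reducedA (applyOp (U ⊗ₖ V) ψ) = U * reducedA ψ * U.conjTranspose := by
    rw [hred, hred, hcoeff, Matrix.conjTranspose_mul, Matrix.conjTranspose_mul]
    calc U * coeff ψ * V.transpose *
          (V.transpose.conjTranspose * ((coeff ψ).conjTranspose * U.conjTranspose))
        = U * coeff ψ * (V.transpose * V.transpose.conjTranspose) *
          ((coeff ψ).conjTranspose * U.conjTranspose) := by simp only [Matrix.mul_assoc]
      _ = _ := by rw [hV', Matrix.mul_one]; simp only [Matrix.mul_assoc]
  have hsq : U * reducedA ψ * U.conjTranspose * (U * reducedA ψ * U.conjTranspose) =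
      U * (reducedA ψ * reducedA ψ) * U.conjTranspose := by
    calc _ = U * reducedA ψ * (U.conjTranspose * U) * reducedA ψ * U.conjTranspose := by
          simp only [Matrix.mul_assoc]
      _ = _ := by rw [hU', Matrix.mul_one]; simp only [Matrix.mul_assoc]
  rw [h, hsq, Matrix.trace_mul_cycle, hU', Matrix.one_mul]

/-- There are no cross terms in the square of a sum of nonnegative numbers only if at most one of
them is nonzero. -/
theorem eq_zero_of_sq_sum_eq_sum_sq {ι : Type*} [Fintype ι] {q : ι → ℝ} (hq : ∀ i, 0 ≤ q i)
    (h : (∑ i, q i) ^ 2 = ∑ i, q i ^ 2) {i j : ι} (hij : i ≠ j) (hi : q i ≠ 0) : q j = 0 := by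
  have hle : ∀ i, q i ≤ ∑ l, q l := fun i =>
    Finset.single_le_sum (fun l _ => hq l) (Finset.mem_univ i)
  have hsum : ∑ i, q i * ((∑ l, q l) - q i) = 0 := by
    simp_rw [mul_sub, Finset.sum_sub_distrib, ← Finset.sum_mul]
    rw [← sq, h, sub_eq_zero]
    exact Finset.sum_congr rfl fun i _ => sq _
  have h0 := (Finset.sum_eq_zero_iff_of_nonneg
    fun i _ => mul_nonneg (hq i) (sub_nonneg.mpr (hle i))).mp hsum i (Finset.mem_univ i)
  have h1 := (mul_eq_zero.mp h0).resolve_left hi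
  have h2 := Finset.add_le_sum (f := q) (s := Finset.univ) (fun l _ => hq l) (Finset.mem_univ i)
    (Finset.mem_univ j) hij
  exact le_antisymm (by linarith) (hq j)

variable [DecidableEq α]

theorem IsFlatMatching.reducedA_trace_sq {ψ : Ket (α × β)} {K : ℝ} (h : IsFlatMatching ψ K) :
    (reducedA ψ * reducedA ψ).trace.re = 1 / K := by
  rw [_root_.reducedA_trace_sq, ← sum_sum_ite_eq_of_flat h.norm_eq_one h.norm_sq_eq
    (fun u v => u.1 = v.1) (fun _ => rfl) (by
      rintro ⟨a, b⟩ ⟨a', b'⟩ hu hv rfl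
      exact Prod.ext rfl (h.snd_unique _ _ _ hu hv)), Fintype.sum_prod_type]
  refine Finset.sum_congr rfl fun a _ => ?_
  rw [Finset.sum_eq_single a, norm_sq_reducedA_apply_self, sq, Finset.sum_mul_sum]
  · refine Finset.sum_congr rfl fun b _ => ?_
    rw [Fintype.sum_prod_type, Finset.sum_eq_single a]
    · simp
    · intro a' _ ha'
      exact Finset.sum_eq_zero fun b' _ => by simp [ha'.symm]
    · simp
  · intro a' _ ha'
    rw [reducedA, Matrix.of_apply, Finset.sum_eq_zero, norm_zero, zero_pow two_ne_zero]
    intro b _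
    by_contra hne
    rw [mul_eq_zero, not_or, map_eq_zero] at hne
    exact ha' (h.fst_unique _ _ _ hne.2 hne.1)
  · simp

variable [DecidableEq β]

theorem IsFlatMatching.sum_norm_pow_four {ψ : Ket (α × β)} {K : ℝ} (h : IsFlatMatching ψ K) :
    ∑ u, (‖ψ u‖ ^ 2) ^ 2 = 1 / K := by
  rw [← sum_sum_ite_eq_of_flat h.norm_eq_one h.norm_sq_eq (fun u v => u = v) (fun _ => rfl)
    fun _ _ _ _ h => h]
  simp [sq]

/-- A state whose nonzero amplitudes all have squared modulus `1 / K` has purity at least `1 / K` on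
`A`, and equality forces its support
to be a matching: a second entry in a row contributes to a diagonal entry of the reduced density
matrix, a second entry in a column to an off-diagonal one. -/
theorem isFlatMatching_of_reducedA_trace_sq {φ : Ket (α × β)} {K : ℝ} (hφ : ‖φ‖ = 1)
    (hflat : ∀ u, φ u ≠ 0 → ‖φ u‖ ^ 2 = 1 / K)
    (hpur : (reducedA φ * reducedA φ).trace.re = 1 / K) : IsFlatMatching φ K := by
  have hfour : ∑ a, ∑ b, (‖φ (a, b)‖ ^ 2) ^ 2 = 1 / K := by
    rw [← Fintype.sum_prod_type fun u : α × β => (‖φ u‖ ^ 2) ^ 2,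
      ← sum_sum_ite_eq_of_flat hφ hflat (fun u v => u = v) (fun _ => rfl) fun _ _ _ _ h => h]
    simp [sq]
  -- The nonnegative terms by which the purity exceeds the sum of the fourth powers.
  let T : α → α → ℝ := fun a a' =>
    ‖reducedA φ a a'‖ ^ 2 - if a = a' then ∑ b, (‖φ (a, b)‖ ^ 2) ^ 2 else 0
  have hT : ∀ a a', 0 ≤ T a a' := by
    intro a a'
    by_cases h : a = a'
    · subst h
      simp only [T, if_true, norm_sq_reducedA_apply_self, sub_nonneg]
      exact Finset.sum_sq_le_sq_sum_of_nonneg fun b _ => sq_nonneg _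
    · simp only [T, if_neg h, sub_zero]
      exact sq_nonneg _
  have hTsum : ∑ a, ∑ a', T a a' = 0 := by
    simp only [T, Finset.sum_sub_distrib, ← reducedA_trace_sq, hpur]
    simp [hfour]
  have hT0 : ∀ a a', T a a' = 0 := fun a a' =>
    (Finset.sum_eq_zero_iff_of_nonneg fun a' _ => hT a a').mp
      ((Finset.sum_eq_zero_iff_of_nonneg fun a _ => Finset.sum_nonneg fun a' _ => hT a a').mp hTsum
        a (Finset.mem_univ a)) a' (Finset.mem_univ a')
  have hsnd : ∀ a b b', φ (a, b) ≠ 0 → φ (a, b') ≠ 0 → b = b' := by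
    intro a b b' hb hb'
    by_contra hne
    have h := hT0 a a
    simp only [T, if_true, norm_sq_reducedA_apply_self, sub_eq_zero] at h
    have := eq_zero_of_sq_sum_eq_sum_sq (fun b => sq_nonneg _) h hne (by simpa using hb)
    exact hb' (by simpa using this)
  refine ⟨hφ, hflat, hsnd, fun a a' b hb hb' => ?_⟩
  by_contra hne
  have h := hT0 a a'
  simp only [T, if_neg hne, sub_zero, sq_eq_zero_iff, norm_eq_zero, reducedA, Matrix.of_apply] at h
  rw [Finset.sum_eq_single b (fun b' _ hbb' => by
    by_contra hne'
    rw [mul_eq_zero, not_or] at hne'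
    exact hbb' (hsnd _ _ _ hne'.1 hb)) (by simp)] at h
  simp [hb, hb'] at h

end Purity

/-! ### The maximally entangled state -/

section MaxEntangled

variable {nA nB k : ℕ}

/-- The support `|z⟩_A ⊗ |z⟩_B`, `z < 2 ^ k`, of the maximally entangled state. -/
def diagLabel (hA : k ≤ nA) (hB : k ≤ nB) (z : Fin (2 ^ k)) : Qubits nA × Qubits nB :=
  (Fin.castLE (Nat.pow_le_pow_right two_pos hA) z, Fin.castLE (Nat.pow_le_pow_right two_pos hB) z)

theorem diagLabel_injective (hA : k ≤ nA) (hB : k ≤ nB) :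
    Function.Injective (diagLabel hA hB) := fun _ _ h =>
  Fin.castLE_injective (Nat.pow_le_pow_right two_pos hA) (Prod.ext_iff.mp h).1

theorem maxEntangled_diagLabel (hA : k ≤ nA) (hB : k ≤ nB) (z : Fin (2 ^ k)) :
    maxEntangled nA nB k (diagLabel hA hB z) = ((1 / Real.sqrt (2 ^ k) : ℝ) : ℂ) := by
  simp only [maxEntangled, diagLabel]
  rw [if_pos ⟨rfl, z.2⟩]

theorem exists_diagLabel_of_maxEntangled_ne_zero (hA : k ≤ nA) (hB : k ≤ nB)
    {x : Qubits nA × Qubits nB} (hx : maxEntangled nA nB k x ≠ 0) : ∃ z, x = diagLabel hA hB z := by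
  simp only [maxEntangled, ne_eq, ite_eq_right_iff, not_forall] at hx
  obtain ⟨⟨h1, h2⟩, -⟩ := hx
  exact ⟨⟨x.1.val, h2⟩, Prod.ext (Fin.ext rfl) (Fin.ext h1.symm)⟩

theorem norm_sq_maxEntangled_diagLabel (hA : k ≤ nA) (hB : k ≤ nB) (z : Fin (2 ^ k)) :
    ‖maxEntangled nA nB k (diagLabel hA hB z)‖ ^ 2 = 1 / (2 : ℝ) ^ k := by
  rw [maxEntangled_diagLabel, Complex.norm_real, Real.norm_eq_abs, sq_abs, div_pow,
    Real.sq_sqrt (by positivity), one_pow]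

theorem isFlatMatching_maxEntangled (hA : k ≤ nA) (hB : k ≤ nB) :
    IsFlatMatching (maxEntangled nA nB k) (2 ^ k) := by
  refine ⟨?_, fun u hu => ?_, fun a b b' hb hb' => ?_, fun a a' b hb hb' => ?_⟩
  · have h : ‖maxEntangled nA nB k‖ ^ 2 = 1 := by
      rw [EuclideanSpace.norm_sq_eq, ← Fintype.sum_of_injective (diagLabel hA hB)
        (diagLabel_injective hA hB) (fun _ => 1 / (2 : ℝ) ^ k) _ (fun x hx => ?_)
        fun z => (norm_sq_maxEntangled_diagLabel hA hB z).symm]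
      · simp
      · by_contra hne
        obtain ⟨z, rfl⟩ := exists_diagLabel_of_maxEntangled_ne_zero hA hB
          (x := x) (by simpa using hne)
        exact hx ⟨z, rfl⟩
    exact (pow_eq_one_iff_of_nonneg (norm_nonneg _) two_ne_zero).mp h
  · obtain ⟨z, rfl⟩ := exists_diagLabel_of_maxEntangled_ne_zero hA hB hu
    exact norm_sq_maxEntangled_diagLabel hA hB z
  · simp only [maxEntangled, ne_eq, ite_eq_right_iff, not_forall] at hb hb'
    exact Fin.ext (hb.1.1.symm.trans hb'.1.1)
  · simp only [maxEntangled, ne_eq, ite_eq_right_iff, not_forall] at hb hb'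
    exact Fin.ext (hb.1.1.trans hb'.1.1.symm)

theorem localPFOrbit_subset {α β : Type} [Fintype α] [Fintype β] [DecidableEq α] [DecidableEq β]
    (ψ : Ket (α × β)) : localPFOrbit ψ ⊆ entEnsemble ψ ∩ cohEnsemble ψ := by
  rintro φ ⟨pA, pB, fA, fB, rfl⟩
  exact ⟨⟨_, mul_mem (permOp_mem_unitaryGroup pA) (phaseOp_mem_unitaryGroup fA), _,
    mul_mem (permOp_mem_unitaryGroup pB) (phaseOp_mem_unitaryGroup fB), rfl⟩,
    ⟨_, _, by rw [localPF_eq]⟩⟩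

/-- A matching in the global permutation-and-phase orbit of the maximally entangled state is in its
local orbit: the two partial injections given by the matching extend to permutations. -/
theorem mem_localPFOrbit_of_isFlatMatching (hA : k ≤ nA) (hB : k ≤ nB)
    {φ : Ket (Qubits nA × Qubits nB)} (hφ : φ ∈ cohEnsemble (maxEntangled nA nB k)) {K : ℝ}
    (hm : IsFlatMatching φ K) : φ ∈ localPFOrbit (maxEntangled nA nB k) := by
  obtain ⟨p, f, rfl⟩ := hφ
  have hval : ∀ x, applyOp (permOp p * phaseOp f) (maxEntangled nA nB k) x =
      Complex.exp (2 * Real.pi * Complex.I * (f (p⁻¹ x) : ℂ)) * maxEntangled nA nB k (p⁻¹ x) :=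
    fun x => by rw [applyOp_mul, applyOp_permOp_apply, applyOp_phaseOp_apply]
  have hne : ∀ z, applyOp (permOp p * phaseOp f) (maxEntangled nA nB k)
      ((p (diagLabel hA hB z)).1, (p (diagLabel hA hB z)).2) ≠ 0 := fun z => by
    rw [hval, Prod.mk.eta, show p⁻¹ (p (diagLabel hA hB z)) = diagLabel hA hB z by simp,
      maxEntangled_diagLabel]
    refine mul_ne_zero (Complex.exp_ne_zero _) (Complex.ofReal_ne_zero.mpr ?_)
    positivity
  have hinj : ∀ z z', p (diagLabel hA hB z) = p (diagLabel hA hB z') → z = z' := fun z z' h =>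
    diagLabel_injective hA hB (p.injective h)
  obtain ⟨pA, hpA⟩ := Equiv.Perm.exists_extending_pair
    (fun z => (diagLabel hA hB z).1) (fun z => (p (diagLabel hA hB z)).1)
    (Fin.castLE_injective (Nat.pow_le_pow_right two_pos hA))
    fun z z' h => hinj z z' (Prod.ext h (by
      have h1 := hne z
      rw [show (p (diagLabel hA hB z)).1 = (p (diagLabel hA hB z')).1 from h] at h1
      exact hm.snd_unique _ _ _ h1 (hne z')))
  obtain ⟨pB, hpB⟩ := Equiv.Perm.exists_extending_pair
    (fun z => (diagLabel hA hB z).2) (fun z => (p (diagLabel hA hB z)).2)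
    (Fin.castLE_injective (Nat.pow_le_pow_right two_pos hB))
    fun z z' h => hinj z z' (Prod.ext (by
      have h1 := hne z
      rw [show (p (diagLabel hA hB z)).2 = (p (diagLabel hA hB z')).2 from h] at h1
      exact hm.fst_unique _ _ _ h1 (hne z')) h)
  -- Each basis vector in the support carries its whole phase on `A`.
  refine ⟨pA, pB, fun a => if h : a.val < 2 ^ k then f (diagLabel hA hB ⟨a, h⟩) else 0,
    fun _ => 0, ?_⟩
  ext x
  rw [hval, applyOp_localPF_apply]
  by_cases hx : ∃ z, x = p (diagLabel hA hB z)
  · obtain ⟨z, rfl⟩ := hx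
    have h : (pA⁻¹ (p (diagLabel hA hB z)).1, pB⁻¹ (p (diagLabel hA hB z)).2) =
        diagLabel hA hB z := by
      rw [← hpA, ← hpB]; simp
    have h1 : pA⁻¹ (p (diagLabel hA hB z)).1 = (diagLabel hA hB z).1 := congrArg Prod.fst h
    rw [h, h1]
    simp [diagLabel]
  · have h1 : maxEntangled nA nB k (p⁻¹ x) = 0 := by
      by_contra h
      obtain ⟨z, hz⟩ := exists_diagLabel_of_maxEntangled_ne_zero hA hB h
      exact hx ⟨z, by rw [← hz]; simp⟩
    have h2 : maxEntangled nA nB k (pA⁻¹ x.1, pB⁻¹ x.2) = 0 := by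
      by_contra h
      obtain ⟨z, hz⟩ := exists_diagLabel_of_maxEntangled_ne_zero hA hB h
      refine hx ⟨z, Prod.ext ?_ ?_⟩
      · rw [← hpA, ← hz]; simp
      · rw [← hpB, ← hz]; simp
    rw [h1, h2, mul_zero, mul_zero]

theorem entEnsemble_inter_cohEnsemble_maxEntangled (hA : k ≤ nA) (hB : k ≤ nB) :
    entEnsemble (maxEntangled nA nB k) ∩ cohEnsemble (maxEntangled nA nB k) =
      localPFOrbit (maxEntangled nA nB k) := by
  refine Set.Subset.antisymm ?_ (localPFOrbit_subset _)
  rintro φ ⟨⟨U, hU, V, hV, hφ⟩, hcoh⟩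
  have hψ := isFlatMatching_maxEntangled hA hB
  refine mem_localPFOrbit_of_isFlatMatching hA hB hcoh
    (isFlatMatching_of_reducedA_trace_sq (K := 2 ^ k) ?_ ?_ ?_)
  · obtain ⟨p, f, rfl⟩ := hcoh
    rw [norm_applyOp (mul_mem (permOp_mem_unitaryGroup p) (phaseOp_mem_unitaryGroup f)),
      hψ.norm_eq_one]
  · obtain ⟨p, f, rfl⟩ := hcoh
    intro u hu
    rw [applyOp_mul, applyOp_permOp_apply, applyOp_phaseOp_apply] at hu ⊢
    rw [norm_mul, norm_exp_phase, one_mul]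
    exact hψ.norm_sq_eq _ (right_ne_zero_of_mul hu)
  · rw [hφ, reducedA_trace_sq_applyOp_kronecker hU hV, hψ.reducedA_trace_sq]

end MaxEntangled

end

theorem theorem8 :
    ∃ C : ℝ, 0 < C ∧ ∀ t : ℕ, 2 ≤ t → ∃ c : ℝ, 0 < c ∧
      ∀ nA nB k : ℕ, 1 ≤ nA + nB → k ≤ min nA nB →
        ∃ ψ : Ket (Qubits nA × Qubits nB),
          ψ = maxEntangled nA nB k ∧ ‖ψ‖ = 1 ∧
          entEntropy ψ = k * Real.log 2 ∧ cohEntropy ψ = k * Real.log 2 ∧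
          entEnsemble ψ ∩ cohEnsemble ψ = localPFOrbit ψ ∧
          c * Real.exp (-entEntropy ψ) ≤ designError t (localPFEnsemble ψ) ∧
          designError t (localPFEnsemble ψ) ≤ C * (t : ℝ) ^ 2 * Real.exp (-entEntropy ψ) ∧
          c * Real.exp (-cohEntropy ψ) ≤ designError t (localPFEnsemble ψ) ∧
          designError t (localPFEnsemble ψ) ≤ C * (t : ℝ) ^ 2 * Real.exp (-cohEntropy ψ) ∧
          designError t (localPFEnsemble ψ) ≤ C * (t : ℝ) ^ 2 / 2 ^ k := by
  refine ⟨6, by norm_num, fun t ht => ⟨1 / 10, by norm_num, fun nA nB k hn hk => ?_⟩⟩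
  have hA : k ≤ nA := hk.trans (min_le_left _ _)
  have hB : k ≤ nB := hk.trans (min_le_right _ _)
  have hψ := isFlatMatching_maxEntangled hA hB
  have hlog : -Real.log (1 / (2 : ℝ) ^ k) = k * Real.log 2 := by
    rw [one_div, Real.log_inv, neg_neg, Real.log_pow]
  have hent : entEntropy (maxEntangled nA nB k) = k * Real.log 2 := by
    rw [entEntropy, hψ.reducedA_trace_sq, hlog]
  have hcoh : cohEntropy (maxEntangled nA nB k) = k * Real.log 2 := by
    rw [cohEntropy, hψ.sum_norm_pow_four, hlog]
  have hexp : Real.exp (-(k * Real.log 2)) = 1 / (2 : ℝ) ^ k := by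
    rw [← hlog, neg_neg, Real.exp_log (by positivity)]
  have hKA : (2 : ℝ) ^ k ≤ 2 ^ nA := pow_le_pow_right₀ one_le_two hA
  have hKB : (2 : ℝ) ^ k ≤ 2 ^ nB := pow_le_pow_right₀ one_le_two hB
  have hup : designError t (localPFEnsemble (maxEntangled nA nB k)) ≤ 6 * (t : ℝ) ^ 2 / 2 ^ k :=
    hψ.designError_le (by positivity) (by simpa using hKA) (by simpa using hKB)
  have hlow : 1 / 10 * (1 / (2 : ℝ) ^ k) ≤
      designError t (localPFEnsemble (maxEntangled nA nB k)) := by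
    refine le_trans ?_ (hψ.le_designError ht)
    simp only [Fintype.card_fin, Nat.cast_pow, Nat.cast_ofNat]
    -- The total dimension is at least `K ^ 2`, and at least `2` in the product case `K = 1`.
    have hmain : 2 / ((2 : ℝ) ^ nA * 2 ^ nB + 1) ≤ 4 / 5 * (1 / 2 ^ k) := by
      rw [mul_one_div, div_div, div_le_div_iff₀ (by positivity) (by positivity)]
      rcases Nat.eq_zero_or_pos k with rfl | hk0
      · have : (2 : ℝ) ^ 1 ≤ 2 ^ (nA + nB) := pow_le_pow_right₀ one_le_two hn
        rw [pow_add] at this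
        linarith
      · have hK : (2 : ℝ) ^ 1 ≤ 2 ^ k := pow_le_pow_right₀ one_le_two hk0
        have hKK : (2 : ℝ) ^ k * 2 ^ k ≤ 2 ^ nA * 2 ^ nB := by gcongr
        nlinarith
    linarith
  refine ⟨_, rfl, hψ.norm_eq_one, hent, hcoh,
    entEnsemble_inter_cohEnsemble_maxEntangled hA hB, ?_, ?_, ?_, ?_, hup⟩
  · rwa [hent, hexp]
  · rwa [hent, hexp, mul_one_div]
  · rwa [hcoh, hexp]
  · rwa [hcoh, hexp, mul_one_div]
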